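/- **Theorem.** Let $j_A,j_B\in\{0,\tfrac12,1,\dots\}$, and let $\mathcal H_A,\mathcal H_B$ be the spin-$j_A$ and spin-$j_B$ spaces with orthonormal bases $|j,m\rangle$, angular momentum operators $\vec J_A,\vec J_B$ and $SU(2)$-representations $U_A(\vec g)=e^{i\vec J_A\cdot\vec g}$, $U_B(\vec g)=e^{i\vec J_B\cdot\vec g}$ ($\vec g\in\mathbb R^3$); put $d_A=2j_A+1$. A covariant channel is a completely positive trace-preserving linear map $\mathcal E:\mathcal B(\mathcal H_A)\to\mathcal B(\mathcal H_B)$ with $U_B(\vec g)^\dagger\,\mathcal E(U_A(\vec g)XU_A(\vec g)^\dagger)\,U_B(\vec g)=\mathcal E(X)$ for all $\vec g$ and $X$. Its Jamiołkowski operator is $\mathcal J(\mathcal E)=(\mathcal E\otimes\mathrm{id})(|\Omega\rangle\langle\Omega|)$ with $|\Omega\rangle=d_A^{-1/2}\sum_a|aa\rangle$. For $L\in\{|j_A-j_B|,|j_A-j_B|+1,\dots,j_A+j_B\}$ let $I^L$ be the orthogonal projector of $\mathcal H_B\otimes\mathcal H_A$ onto the subspace carrying the spin-$L$ irrep of $U_B\otimes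 U_A^*$, and let $\mathcal E^L$ be the linear map with $\mathcal J(\mathcal E^L)=I^L/(2L+1)$. Let $\{T^l_k\}_{0\le l\le 2j_A,\,-l\le k\le l}$ and $\{S^l_k\}_{0\le l\le 2j_B,\,-l\le k\le l}$ be orthonormal (for the Hilbert–Schmidt product) families of irreducible tensor operators on $\mathcal H_A$ and $\mathcal H_B$: $U T^l_kU^\dagger=\sum_{k'}v^l_{k'k}T^l_{k'}$ with $v^l$ the matrix of the spin-$l$ representation in its standard basis, and likewise for $S$. Then: 1. The subspace carrying the irrep $L$ has dimension $2L+1$, and each $\mathcal E^L$ is a covariant channel. 2. For every covariant channel $\mathcal E$ there is a unique probability distribution $(p_L)$ on the $2\min(j_A,j_B)+1$ values of $L$ with $\mathcal E=\sum_L p_L\mathcal E^L$; conversely, every such convex combination is a covariant channel. 3. Every covariant channel $\mathcal E$ satisfies $\mathcal E(T^l_k)=f_l(\mathcal E)S^l_k$ for $l\le 2\min(j_A,j_B)$, where $f_l(\mathcal E)=\mathrm{tr}\big((S^l_0)^\dagger\mathcal E(T^l_0)\big)$, and $\mathcal E(T^l_k)=0$ for $2j_B<l\le 2j_A$. If $\mathcal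 E=\sum_Lp_L\mathcal E^L$ then $f_l(\mathcal E)=\sum_L p_Lf_l(\mathcal E^L)$ and, for all $X$, $$\mathcal E(X)=\sum_{L=|j_A-j_B|}^{j_A+j_B}\ \sum_{l=0}^{2\min(j_A,j_B)}\ \sum_{k=-l}^{l}p_L\,f_l(\mathcal E^L)\,\mathrm{tr}\big((T^l_k)^\dagger X\big)\,S^l_k .$$ 4. There are reduced matrix elements with $\langle j_A,m'|T^l_k|j_A,m\rangle=\langle j_A,m;l,k|j_A,m'\rangle\,\langle j_A\|T^l\|j_A\rangle$ for $l\le2j_A$ and $\langle j_B,m'|S^l_k|j_B,m\rangle=\langle j_B,m;l,k|j_B,m'\rangle\,\langle j_B\|S^l\|j_B\rangle$ for $l\le2j_B$. For all $L$ and all $l\le 2\min(j_A,j_B)$ the denominators below are non-zero and $$f_l(\mathcal E^L)=\frac{\langle j_A\|T^l\|j_A\rangle}{\langle j_B\|S^l\|j_B\rangle}\sum_{k=-L}^{L}\frac{\langle j_A,j_B+k;\,l,0\,|\,j_A,j_B+k\rangle}{\langle j_B,j_B;\,l,0\,|\,j_B,j_B\rangle}\;\langle j_B,j_B;\,L,k\,|\,j_A,j_B+k\rangle^2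 .$$ Here $\langle\cdot;\cdot|\cdot\rangle$ are the Clebsch–Gordan coefficients in the Condon–Shortley convention, zero for inadmissible magnetic numbers. 5. Let $j_A,j_B\ge\tfrac12$, and let $\|\vec J\|=\sqrt{j(j+1)(2j+1)}$ for each of the two spins. For $a\in\{x,y,z\}$, $$\mathcal E^L\!\left(\frac{\sqrt3\,J_A^a}{\|\vec J_A\|}\right)=f_1\,\frac{\sqrt3\,J_B^a}{\|\vec J_B\|},\qquad f_1=\frac{j_A(j_A+1)+j_B(j_B+1)-L(L+1)}{2j_B(j_B+1)}\sqrt{\frac{j_B(j_B+1)(2j_A+1)}{j_A(j_A+1)(2j_B+1)}},$$ and $f_1(\mathcal E^L)=f_1$ whenever $T^1_0=\sqrt3J_A^z/\|\vec J_A\|$ and $S^1_0=\sqrt3J_B^z/\|\vec J_B\|$. -/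

import Mathlib

open scoped Matrix Kronecker ComplexOrder

noncomputable section

namespace SU2Channel

/-! Spins are labelled by the natural number `n = 2j`.  The spin-`j` space has the orthonormal
basis `|j,m⟩` indexed by `i : Fin (n + 1)`, where `m = i - j`, so `m` runs through
`-j, -j+1, …, j`. -/

/-- Operators on the spin-`n/2` space, in the basis `|j,m⟩`. -/
abbrev Op (n : ℕ) := Matrix (Fin (n + 1)) (Fin (n + 1)) ℂ

/-- The spin `j = n/2`. -/
def spin (n : ℕ) : ℝ := (n : ℝ) / 2

/-- Twice the magnetic quantum number of the basis vector with index `i`, i.e. `2m = 2i - n`. -/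
def twoM (n : ℕ) (i : Fin (n + 1)) : ℤ := 2 * (i : ℤ) - (n : ℤ)

/-- The magnetic quantum number `m` of the basis vector with index `i`. -/
def mag (n : ℕ) (i : Fin (n + 1)) : ℝ := (twoM n i : ℝ) / 2

/-- The raising operator: `J₊ |j,m⟩ = √(j(j+1) - m(m+1)) |j,m+1⟩`. -/
def raising (n : ℕ) : Matrix (Fin (n + 1)) (Fin (n + 1)) ℝ :=
  Matrix.of fun i' i =>
    if (i' : ℕ) = (i : ℕ) + 1 then
      Real.sqrt (spin n * (spin n + 1) - mag n i * (mag n i + 1)) else 0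

/-- The lowering operator, the adjoint of the raising operator. -/
def lowering (n : ℕ) : Matrix (Fin (n + 1)) (Fin (n + 1)) ℝ := (raising n)ᵀ

def Jplus (n : ℕ) : Op n := (raising n).map (fun x : ℝ => (x : ℂ))

def Jminus (n : ℕ) : Op n := (lowering n).map (fun x : ℝ => (x : ℂ))

/-- The generators `J^x, J^y, J^z` (components `0, 1, 2`) of the spin-`n/2` representation. -/
def J (n : ℕ) : Fin 3 → Op n :=
  ![(1 / 2 : ℂ) • (Jplus n + Jminus n),
    (1 / (2 * Complex.I) : ℂ) • (Jplus n - Jminus n),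
    Matrix.diagonal fun i => (mag n i : ℂ)]

/-- The operator `exp (i J·v)` by which the rotation `exp (i (σ/2)·v)` in SU(2) acts on the
spin-`n/2` space; every element of SU(2) is of this form. -/
def U (n : ℕ) (v : Fin 3 → ℝ) : Op n :=
  NormedSpace.exp (Complex.I • ∑ a, (v a : ℂ) • J n a)

/-! ### Channels -/

/-- `id_d ⊗ E` on `d × d` block matrices. -/
def amplify {nA nB : ℕ} (E : Op nA →ₗ[ℂ] Op nB) (d : ℕ)
    (M : Matrix (Fin d × Fin (nA + 1)) (Fin d × Fin (nA + 1)) ℂ) :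
    Matrix (Fin d × Fin (nB + 1)) (Fin d × Fin (nB + 1)) ℂ :=
  Matrix.of fun x y => E (Matrix.of fun a a' => M (x.1, a) (y.1, a')) x.2 y.2

/-- A completely positive, trace-preserving linear map. -/
structure IsChannel {nA nB : ℕ} (E : Op nA →ₗ[ℂ] Op nB) : Prop where
  completely_positive : ∀ (d : ℕ) (M : Matrix (Fin d × Fin (nA + 1)) (Fin d × Fin (nA + 1)) ℂ),
    M.PosSemidef → (amplify E d M).PosSemidef
  trace_preserving : ∀ X : Op nA, (E X).trace = X.trace

/-- A channel with `U_B† E(U_A X U_A†) U_B = E(X)` for all rotations. -/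
structure IsCovariantChannel {nA nB : ℕ} (E : Op nA →ₗ[ℂ] Op nB) : Prop where
  isChannel : IsChannel E
  covariant : ∀ (v : Fin 3 → ℝ) (X : Op nA),
    (U nB v)ᴴ * E (U nA v * X * (U nA v)ᴴ) * U nB v = E X

/-- The Jamiołkowski operator `(E ⊗ id)|Ω⟩⟨Ω|` on `H_B ⊗ H_A`, where
`|Ω⟩ = d_A^{-1/2} ∑ₐ |aa⟩`. -/
def jamiolkowski {nA nB : ℕ} (E : Op nA →ₗ[ℂ] Op nB) :
    Matrix (Fin (nB + 1) × Fin (nA + 1)) (Fin (nB + 1) × Fin (nA + 1)) ℂ :=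
  Matrix.of fun x y => (1 / ((nA : ℂ) + 1)) * E (Matrix.single x.2 y.2 1) x.1 y.1

/-- The tensor representation `U_B ⊗ U_A^*` on `H_B ⊗ H_A`, with `U_A^*` the entrywise complex
conjugate. -/
def tensorRep (nA nB : ℕ) (v : Fin 3 → ℝ) :
    Matrix (Fin (nB + 1) × Fin (nA + 1)) (Fin (nB + 1) × Fin (nA + 1)) ℂ :=
  U nB v ⊗ₖ (U nA v).map (starRingEnd ℂ)

/-- The subspace of `H_B ⊗ H_A` carrying the spin-`n/2` irrep of `U_B ⊗ U_A^*`: the sum of the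
images of all intertwiners from the spin-`n/2` representation. -/
def irrepSubspace (nA nB n : ℕ) :
    Submodule ℂ (EuclideanSpace ℂ (Fin (nB + 1) × Fin (nA + 1))) :=
  ⨆ φ : {φ : EuclideanSpace ℂ (Fin (n + 1)) →ₗ[ℂ]
          EuclideanSpace ℂ (Fin (nB + 1) × Fin (nA + 1)) //
        ∀ v : Fin 3 → ℝ,
          φ ∘ₗ Matrix.toEuclideanLin (U n v) = Matrix.toEuclideanLin (tensorRep nA nB v) ∘ₗ φ},
    LinearMap.range φ.1

/-- The operator `I^L`: the orthogonal projector of `H_B ⊗ H_A` onto the subspace carrying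
the spin-`n/2` irrep, `L = n/2`. -/
def irrepProjector (nA nB n : ℕ) :
    Matrix (Fin (nB + 1) × Fin (nA + 1)) (Fin (nB + 1) × Fin (nA + 1)) ℂ :=
  Matrix.toEuclideanLin.symm (irrepSubspace nA nB n).starProjection.toLinearMap

/-- The map `X ↦ d_A tr_A (K (1 ⊗ Xᵀ))` whose Jamiołkowski operator is `K`. -/
def ofJamiolkowski (nA nB : ℕ)
    (K : Matrix (Fin (nB + 1) × Fin (nA + 1)) (Fin (nB + 1) × Fin (nA + 1)) ℂ) :
    Op nA →ₗ[ℂ] Op nB where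
  toFun X := Matrix.of fun b b' => ((nA : ℂ) + 1) * ∑ a, ∑ a', K (b, a) (b', a') * X a a'
  map_add' X Y := by
    ext b b'
    simp [mul_add, Finset.sum_add_distrib]
  map_smul' c X := by
    ext b b'
    simp only [Matrix.of_apply, Matrix.smul_apply, smul_eq_mul, RingHom.id_apply, Finset.mul_sum]
    refine Finset.sum_congr rfl fun a _ => Finset.sum_congr rfl fun a' _ => ?_
    ring

/-- The values `2L` for `L = |j_A - j_B|, …, j_A + j_B` in steps of one, enumerated by
`t = 0, …, 2 min(j_A, j_B)`. -/
def twoL (nA nB : ℕ) (t : Fin (min nA nB + 1)) : ℕ := (max nA nB - min nA nB) + 2 * (t : ℕ)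

/-- The map `E^L` with Jamiołkowski operator `I^L / (2L+1)`. -/
def extremal (nA nB : ℕ) (t : Fin (min nA nB + 1)) : Op nA →ₗ[ℂ] Op nB :=
  ofJamiolkowski nA nB
    ((1 / ((twoL nA nB t : ℂ) + 1)) • irrepProjector nA nB (twoL nA nB t))

/-! ### Clebsch–Gordan coefficients (Condon–Shortley convention) -/

/-- The total lowering operator on the tensor product of spins `n₁/2` and `n₂/2`. -/
def totalLowering (n₁ n₂ : ℕ) :
    Matrix (Fin (n₁ + 1) × Fin (n₂ + 1)) (Fin (n₁ + 1) × Fin (n₂ + 1)) ℝ :=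
  lowering n₁ ⊗ₖ 1 + 1 ⊗ₖ lowering n₂

/-- The unnormalised highest-weight vector `|J,J⟩`, `J = n₃/2`, with coefficients
`(-1)^{j₁-m₁} √((j₁+m₁)! (j₂+m₂)! / ((j₁-m₁)! (j₂-m₂)!))` at `m₁ + m₂ = J`. -/
def highestWeight (n₁ n₂ n₃ : ℕ) : Fin (n₁ + 1) × Fin (n₂ + 1) → ℝ := fun x =>
  if twoM n₁ x.1 + twoM n₂ x.2 = (n₃ : ℤ) then
    (-1) ^ (n₁ - (x.1 : ℕ)) *
      Real.sqrt (((x.1 : ℕ).factorial * (x.2 : ℕ).factorial : ℝ) /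
        ((n₁ - (x.1 : ℕ)).factorial * (n₂ - (x.2 : ℕ)).factorial : ℝ))
  else 0

/-- The total angular momentum state `|J,M⟩`, obtained from the normalised highest-weight vector as
`√((J+M)! / ((2J)! (J-M)!)) (J₋)^{J-M} |J,J⟩`. -/
def coupledState (n₁ n₂ n₃ : ℕ) (c : Fin (n₃ + 1)) : Fin (n₁ + 1) × Fin (n₂ + 1) → ℝ :=
  (Real.sqrt (((c : ℕ).factorial : ℝ) / (n₃.factorial * (n₃ - (c : ℕ)).factorial : ℝ)) /
      Real.sqrt (∑ x, highestWeight n₁ n₂ n₃ x ^ 2)) •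
    ((totalLowering n₁ n₂ ^ (n₃ - (c : ℕ))) *ᵥ highestWeight n₁ n₂ n₃)

/-- The Clebsch–Gordan coefficient `⟨j₁,m₁; j₂,m₂ | J,M⟩`; the arguments are the doubled quantum
numbers `2j₁, 2m₁, 2j₂, 2m₂, 2J, 2M`.  It is `0` when the triangle condition
`|j₁-j₂| ≤ J ≤ j₁+j₂` fails or when some magnetic number is not admissible. -/
def cg (n₁ : ℕ) (μ₁ : ℤ) (n₂ : ℕ) (μ₂ : ℤ) (n₃ : ℕ) (μ₃ : ℤ) : ℝ :=
  if n₁ ≤ n₂ + n₃ ∧ n₂ ≤ n₁ + n₃ ∧ n₃ ≤ n₁ + n₂ then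
    ∑ a, ∑ b, ∑ c,
      if twoM n₁ a = μ₁ ∧ twoM n₂ b = μ₂ ∧ twoM n₃ c = μ₃ then coupledState n₁ n₂ n₃ c (a, b)
      else 0
  else 0

/-! ### Irreducible tensor operators -/

/-- `T l k`, for `l = 0, …, n` and `k` the index of the magnetic number in `{-l, …, l}`, is a
normalised family of irreducible tensor operators on the spin-`n/2` space:
`U T^l_k U† = ∑_{k'} v^l_{k'k} T^l_{k'}`, where `v^l` is the spin-`l` representation.
The values of `T l` with `l > n` play no role. -/
structure IsITOBasis (n : ℕ) (T : (l : ℕ) → Fin (2 * l + 1) → Op n) : Prop where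
  transforms : ∀ l ≤ n, ∀ (k : Fin (2 * l + 1)) (v : Fin 3 → ℝ),
    U n v * T l k * (U n v)ᴴ = ∑ k', U (2 * l) v k' k • T l k'
  orthonormal : ∀ l ≤ n, ∀ l' ≤ n, ∀ (k : Fin (2 * l + 1)) (k' : Fin (2 * l' + 1)),
    ((T l' k')ᴴ * T l k).trace = if l = l' ∧ (k : ℕ) = (k' : ℕ) then 1 else 0

/-- The index of the component `k = 0` of a rank-`l` tensor. -/
def midIdx (l : ℕ) : Fin (2 * l + 1) := ⟨l, by omega⟩

/-- `r` is the reduced matrix element of the rank-`l` tensor operator `T`: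
`⟨j,m'|T_k|j,m⟩ = ⟨j,m; l,k | j,m'⟩ r`. -/
def IsReducedElement (n l : ℕ) (T : Fin (2 * l + 1) → Op n) (r : ℂ) : Prop :=
  ∀ (k : Fin (2 * l + 1)) (m m' : Fin (n + 1)),
    T k m' m = (cg n (twoM n m) (2 * l) (twoM (2 * l) k) n (twoM n m') : ℂ) * r

/-- The scaling factor `f_l(E)`, a diagonal entry `tr ((S^l_k)† E(T^l_k))` (at `k = 0`) of the
Liouville representation. -/
def scaling {nA nB : ℕ} (T : (l : ℕ) → Fin (2 * l + 1) → Op nA)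
    (S : (l : ℕ) → Fin (2 * l + 1) → Op nB) (E : Op nA →ₗ[ℂ] Op nB) (l : ℕ) : ℂ :=
  ((S l (midIdx l))ᴴ * E (T l (midIdx l))).trace

/-- The length `‖J‖ = √(3 tr (J^z)²) = √(j(j+1)(2j+1))`. -/
def spinLength (n : ℕ) : ℝ := Real.sqrt (spin n * (spin n + 1) * (2 * spin n + 1))

/-- The component `a` of the angular momentum divided by `‖J‖/√3`. -/
def normJ (n : ℕ) (a : Fin 3) : Op n := ((spinLength n / Real.sqrt 3 : ℝ) : ℂ)⁻¹ • J n a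

/-- The closed form of the scaling factor for `l = 1`. -/
def fOne (jA jB L : ℝ) : ℝ :=
  (jA * (jA + 1) + jB * (jB + 1) - L * (L + 1)) / (2 * jB * (jB + 1)) *
    Real.sqrt ((jB * (jB + 1) * (2 * jA + 1)) / (jA * (jA + 1) * (2 * jB + 1)))

end SU2Channel

end

open SU2Channel

namespace SU2Channel

/-! ### Ladder operators -/

/-! A linear map is determined by its Jamiołkowski operator, and covariance says that this operator
commutes with `U_B ⊗ U_A^*` (`covariant_iff`). Differentiating one-parameter subgroups in one
direction and exponentiating in the other turns every such statement into a relation for three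
Hermitian generators (`Intertwines`, `tensorRep_mul_iff`). Schur's lemma is then elementary: the
Casimir separates different spins, and the ladder structure forces scalars within one spin.

The representation on `H_B ⊗ H_A^*` is multiplicity free. An explicit isometric intertwiner is built
for each `L` from Clebsch–Gordan coefficients (`irrepEmbedding`), and since the dimensions `2L+1`
add up to `d_A d_B`, these exhaust the space (`IsDecomposition.sum_mul_conjTranspose`). Hence the
Jamiołkowski operator of a covariant channel is a combination of the projectors `I^L`. Complete
positivity makes the weights nonnegative, trace preservation makes them sum to one, and the
eigenvalues on the blocks make them unique. Conversely, `E^L` has Kraus operators with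
Clebsch–Gordan entries (`extremal_apply`), whose completeness relation is the orthonormality of
coupled states.

The same Schur argument on `H ⊗ H^*`, decomposed by the irreducible tensor operators, shows that a
covariant channel rescales each rank (`IsCovariantChannel.map_tensor`) and gives Wigner–Eckart.
Comparing the highest-weight diagonal entries of `E^L(T^l_0) = f_l S^l_0` yields the Clebsch–Gordan
formula. For `l = 1` the scalar comes from computing `∑ₐ tr(J_B^a E^L(J_A^a))` in two ways, using a
Casimir identity for the Kraus operators (`sum_J_mul_kraus_mul_J`). -/

theorem raising_apply (n : ℕ) (i' i : Fin (n + 1)) :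
    raising n i' i = if (i' : ℕ) = (i : ℕ) + 1 then
      Real.sqrt (((i : ℕ) + 1 : ℝ) * ((n : ℝ) - (i : ℕ))) else 0 := by
  simp only [raising, Matrix.of_apply, spin, mag, twoM]
  congr 2
  push_cast
  ring

theorem lowering_apply (n : ℕ) (i' i : Fin (n + 1)) :
    lowering n i' i = if (i : ℕ) = (i' : ℕ) + 1 then
      Real.sqrt (((i' : ℕ) + 1 : ℝ) * ((n : ℝ) - (i' : ℕ))) else 0 :=
  raising_apply n i i'

/-- A row of the raising operator applied to the restriction of a function on `ℕ`. -/
theorem sum_raising_mul (n : ℕ) (g : ℕ → ℝ) (i : Fin (n + 1)) :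
    ∑ j : Fin (n + 1), raising n i j * g j =
      Real.sqrt ((i : ℕ) * ((n : ℝ) + 1 - (i : ℕ))) * g ((i : ℕ) - 1) := by
  obtain ⟨i, hi⟩ := i
  rcases i with _ | i
  -- At `i = 0` the truncated index `i - 1` is harmless because its coefficient is `√0`.
  · simp [raising_apply]
  · rw [Finset.sum_eq_single (⟨i, by omega⟩ : Fin (n + 1))]
    · simp only [raising_apply, if_true, Nat.add_sub_cancel]
      congr 2
      push_cast
      ring
    · intro j _ hj
      rw [raising_apply, if_neg, zero_mul]
      intro h
      apply hj
      ext
      simp only at h ⊢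
      omega
    · simp

/-- A row of the lowering operator applied to the restriction of a function on `ℕ`. -/
theorem sum_lowering_mul (n : ℕ) (g : ℕ → ℝ) (i : Fin (n + 1)) :
    ∑ j : Fin (n + 1), lowering n i j * g j =
      Real.sqrt (((i : ℕ) + 1) * ((n : ℝ) - (i : ℕ))) * g ((i : ℕ) + 1) := by
  by_cases hi : (i : ℕ) = n
  · rw [Finset.sum_eq_zero]
    -- At the top index the value `g (n + 1)`, outside the basis, is multiplied by `√0`.
    · simp [hi]
    · intro j _
      rw [lowering_apply, if_neg (by omega), zero_mul]
  · rw [Finset.sum_eq_single (⟨i + 1, by omega⟩ : Fin (n + 1))]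
    · simp [lowering_apply]
    · intro j _ hj
      rw [lowering_apply, if_neg, zero_mul]
      intro h
      exact hj (Fin.ext h)
    · simp

theorem raising_mul_lowering (n : ℕ) : raising n * lowering n =
    Matrix.diagonal fun i : Fin (n + 1) => ((i : ℕ) : ℝ) * ((n : ℝ) + 1 - (i : ℕ)) := by
  ext i k
  have h0 : 0 ≤ ((i : ℕ) : ℝ) * ((n : ℝ) + 1 - (i : ℕ)) := by
    have : ((i : ℕ) : ℝ) ≤ n := by exact_mod_cast Nat.lt_succ_iff.mp i.2
    exact mul_nonneg (by positivity) (by linarith)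
  have := sum_raising_mul n (fun j => if (k : ℕ) = j + 1 then
    Real.sqrt (((j : ℕ) + 1 : ℝ) * ((n : ℝ) - (j : ℕ))) else 0) i
  simp only [Matrix.mul_apply, lowering_apply, this, Matrix.diagonal_apply]
  obtain ⟨i, hi⟩ := i
  rcases i with _ | i
  · simp
  · by_cases hk : (⟨i + 1, hi⟩ : Fin (n + 1)) = k
    · subst hk
      have e : ((i : ℝ) + 1) * ((n : ℝ) - i) =
          ((i + 1 : ℕ) : ℝ) * ((n : ℝ) + 1 - ((i + 1 : ℕ) : ℝ)) := by
        push_cast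
        ring
      simp only [Nat.add_sub_cancel, if_true, e]
      exact Real.mul_self_sqrt h0
    · have : ¬ ((k : ℕ) = i + 1) := fun h => hk (Fin.ext h.symm)
      simp [hk, this]

theorem lowering_mul_raising (n : ℕ) : lowering n * raising n =
    Matrix.diagonal fun i : Fin (n + 1) => (((i : ℕ) : ℝ) + 1) * ((n : ℝ) - (i : ℕ)) := by
  ext i k
  have h0 : 0 ≤ (((i : ℕ) : ℝ) + 1) * ((n : ℝ) - (i : ℕ)) := by
    have : ((i : ℕ) : ℝ) ≤ n := by exact_mod_cast Nat.lt_succ_iff.mp i.2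
    exact mul_nonneg (by positivity) (by linarith)
  have := sum_lowering_mul n (fun j => if j = (k : ℕ) + 1 then
    Real.sqrt (((k : ℕ) + 1 : ℝ) * ((n : ℝ) - (k : ℕ))) else 0) i
  simp only [Matrix.mul_apply, raising_apply, this, Matrix.diagonal_apply]
  by_cases hk : i = k
  · subst hk
    simp [Real.mul_self_sqrt h0]
  · have : ¬ ((i : ℕ) = k) := fun h => hk (Fin.ext h)
    simp [hk, this]

/-- The real diagonal matrix `J^z`. -/
noncomputable def weight (n : ℕ) : Matrix (Fin (n + 1)) (Fin (n + 1)) ℝ :=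
  Matrix.diagonal (mag n)

theorem mag_eq (n : ℕ) (i : Fin (n + 1)) : mag n i = (i : ℕ) - (n : ℝ) / 2 := by
  simp only [mag, twoM]
  push_cast
  ring

theorem raising_commutator (n : ℕ) :
    raising n * lowering n - lowering n * raising n = (2 : ℝ) • weight n := by
  rw [raising_mul_lowering, lowering_mul_raising, weight, Matrix.diagonal_sub,
    ← Matrix.diagonal_smul]
  congr 1
  ext i
  simp only [Pi.smul_apply, smul_eq_mul, mag_eq]
  ring

theorem weight_commutator_lowering (n : ℕ) :
    weight n * lowering n - lowering n * weight n = - lowering n := by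
  ext i j
  simp only [weight, Matrix.sub_apply, Matrix.diagonal_mul, Matrix.mul_diagonal,
    Matrix.neg_apply, lowering_apply, mag_eq]
  split_ifs with h
  · rw [h]
    push_cast
    ring
  · ring

theorem spin_mul (n : ℕ) (i : Fin (n + 1)) :
    ((i : ℕ) : ℝ) * ((n : ℝ) + 1 - (i : ℕ)) + (((i : ℕ) : ℝ) + 1) * ((n : ℝ) - (i : ℕ)) =
      2 * (spin n * (spin n + 1) - mag n i * mag n i) := by
  rw [mag_eq, spin]
  ring

/-! ### Angular momentum matrices -/

theorem J_zero (n : ℕ) : J n 0 = (1 / 2 : ℂ) • (Jplus n + Jminus n) := rfl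

theorem J_one (n : ℕ) : J n 1 = (1 / (2 * Complex.I) : ℂ) • (Jplus n - Jminus n) := rfl

theorem J_two (n : ℕ) : J n 2 = Matrix.diagonal fun i => (mag n i : ℂ) := rfl

theorem J_two' (n : ℕ) : J n 2 = (weight n).map (fun x : ℝ => (x : ℂ)) := by
  rw [J_two, weight, Matrix.diagonal_map (by simp)]

theorem J_plus (n : ℕ) : J n 0 + Complex.I • J n 1 = Jplus n := by
  rw [J_zero, J_one, smul_smul]
  have : Complex.I * (1 / (2 * Complex.I)) = 1 / 2 := by field_simp
  rw [this, ← smul_add]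
  ext i j
  simp only [Matrix.smul_apply, Matrix.add_apply, Matrix.sub_apply, smul_eq_mul]
  ring

theorem J_minus (n : ℕ) : J n 0 - Complex.I • J n 1 = Jminus n := by
  rw [J_zero, J_one, smul_smul]
  have : Complex.I * (1 / (2 * Complex.I)) = 1 / 2 := by field_simp
  rw [this, ← smul_sub]
  ext i j
  simp only [Matrix.smul_apply, Matrix.add_apply, Matrix.sub_apply, smul_eq_mul]
  ring

theorem map_ofReal_mul {l m n : Type*} [Fintype m] (A : Matrix l m ℝ) (B : Matrix m n ℝ) :
    (A * B).map (fun x : ℝ => (x : ℂ)) =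
      A.map (fun x : ℝ => (x : ℂ)) * B.map (fun x : ℝ => (x : ℂ)) :=
  Matrix.map_mul (f := Complex.ofRealHom)

theorem Jplus_conjTranspose (n : ℕ) : (Jplus n)ᴴ = Jminus n := by
  ext i j
  simp [Jplus, Jminus, lowering]

theorem Jminus_conjTranspose (n : ℕ) : (Jminus n)ᴴ = Jplus n := by
  rw [← Jplus_conjTranspose, Matrix.conjTranspose_conjTranspose]

theorem J_isHermitian (n : ℕ) (a : Fin 3) : (J n a)ᴴ = J n a := by
  fin_cases a
  · simp [J_zero, Jplus_conjTranspose, Jminus_conjTranspose, add_comm]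
  · simp only [Fin.mk_one, J_one, Matrix.conjTranspose_smul, Matrix.conjTranspose_sub,
      Jplus_conjTranspose, Jminus_conjTranspose]
    rw [← neg_sub, smul_neg, ← neg_smul]
    congr 1
    simp
  · ext i j
    by_cases h : i = j
    · subst h; simp [J_two]
    · simp [J_two, h, Ne.symm h]

/-- Since `Jx² + Jy² = (J₊J₋ + J₋J₊)/2`, all terms are diagonal and the entries add up to `j(j+1)`.
This invariant distinguishes the spins. -/
theorem casimir (n : ℕ) :
    ∑ a, J n a * J n a = ((spin n * (spin n + 1) : ℝ) : ℂ) • (1 : Op n) := by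
  have h1 : J n 0 * J n 0 + J n 1 * J n 1 =
      (1 / 2 : ℂ) • (Jplus n * Jminus n + Jminus n * Jplus n) := by
    rw [J_zero, J_one]
    simp only [Matrix.smul_mul, Matrix.mul_smul, Matrix.add_mul, Matrix.mul_add,
      Matrix.sub_mul, Matrix.mul_sub]
    have : (1 / (2 * Complex.I) : ℂ) * (1 / (2 * Complex.I)) = -(1 / 4) := by
      field_simp
      rw [Complex.I_sq]
      norm_num
    ext i j
    simp only [Matrix.smul_apply, Matrix.add_apply, Matrix.sub_apply, smul_eq_mul]
    linear_combination ((Jplus n * Jplus n) i j - (Jminus n * Jplus n) i j -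
      (Jplus n * Jminus n) i j + (Jminus n * Jminus n) i j) * this
  rw [Fin.sum_univ_three, h1, Jplus, Jminus, ← map_ofReal_mul, ← map_ofReal_mul,
    raising_mul_lowering, lowering_mul_raising, J_two]
  ext i j
  by_cases h : i = j
  · subst h
    have := spin_mul n i
    have h2 := congrArg (fun x : ℝ => (x : ℂ)) this
    push_cast at h2
    simp only [Matrix.add_apply, Matrix.smul_apply, Matrix.map_apply, Matrix.diagonal_apply_eq,
      Matrix.diagonal_mul_diagonal, Matrix.one_apply_eq, smul_eq_mul]
    push_cast
    rw [h2]
    ring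
  · simp [h]

/-! ### Intertwining matrices -/

section Intertwines

variable {ι κ μ : Type*} [Fintype ι] [Fintype κ] [Fintype μ]

/-- `F` intertwines the operators `𝒜` with the operators `ℬ`. -/
def Intertwines (𝒜 : Fin 3 → Matrix ι ι ℂ) (F : Matrix ι κ ℂ) (ℬ : Fin 3 → Matrix κ κ ℂ) : Prop :=
  ∀ a, 𝒜 a * F = F * ℬ a

theorem Intertwines.comp {𝒜 : Fin 3 → Matrix ι ι ℂ} {F : Matrix ι κ ℂ} {ℬ : Fin 3 → Matrix κ κ ℂ}
    {G : Matrix κ μ ℂ} {𝒞 : Fin 3 → Matrix μ μ ℂ} (hF : Intertwines 𝒜 F ℬ)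
    (hG : Intertwines ℬ G 𝒞) : Intertwines 𝒜 (F * G) 𝒞 := fun a => by
  rw [← Matrix.mul_assoc, hF a, Matrix.mul_assoc, hG a, Matrix.mul_assoc]

theorem Intertwines.conjTranspose {𝒜 : Fin 3 → Matrix ι ι ℂ} {F : Matrix ι κ ℂ}
    {ℬ : Fin 3 → Matrix κ κ ℂ} (hF : Intertwines 𝒜 F ℬ) (h𝒜 : ∀ a, (𝒜 a)ᴴ = 𝒜 a)
    (hℬ : ∀ a, (ℬ a)ᴴ = ℬ a) : Intertwines ℬ Fᴴ 𝒜 := fun a => by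
  have := congrArg Matrix.conjTranspose (hF a)
  rw [Matrix.conjTranspose_mul, Matrix.conjTranspose_mul, h𝒜, hℬ] at this
  exact this.symm

theorem Intertwines.smul {𝒜 : Fin 3 → Matrix ι ι ℂ} {F : Matrix ι κ ℂ}
    {ℬ : Fin 3 → Matrix κ κ ℂ} (hF : Intertwines 𝒜 F ℬ) (c : ℂ) : Intertwines 𝒜 (c • F) ℬ :=
  fun a => by rw [Matrix.mul_smul, Matrix.smul_mul, hF a]

/-- A change of basis of the complexified Lie algebra. In the ladder form all matrices are real with
explicit entries. -/
theorem intertwines_iff_ladder {𝒜 : Fin 3 → Matrix ι ι ℂ} {F : Matrix ι κ ℂ}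
    {ℬ : Fin 3 → Matrix κ κ ℂ} : Intertwines 𝒜 F ℬ ↔
      (𝒜 0 + Complex.I • 𝒜 1) * F = F * (ℬ 0 + Complex.I • ℬ 1) ∧
      (𝒜 0 - Complex.I • 𝒜 1) * F = F * (ℬ 0 - Complex.I • ℬ 1) ∧ 𝒜 2 * F = F * ℬ 2 := by
  simp only [Matrix.add_mul, Matrix.mul_add, Matrix.sub_mul, Matrix.mul_sub, Matrix.smul_mul,
    Matrix.mul_smul]
  constructor
  · intro h
    simp [h 0, h 1, h 2]
  · rintro ⟨h1, h2, h3⟩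
    have e0 : 𝒜 0 * F = F * ℬ 0 := by
      have := congrArg₂ (· + ·) h1 h2
      simp only [add_add_sub_cancel, ← two_smul ℂ] at this
      exact (smul_right_injective _ (two_ne_zero)) this
    have e1 : 𝒜 1 * F = F * ℬ 1 := by
      rw [e0] at h1
      exact (smul_right_injective _ Complex.I_ne_zero) (add_left_cancel h1)
    intro a
    fin_cases a
    exacts [e0, e1, h3]

/-- Schur's lemma for inequivalent spins. -/
theorem Intertwines.eq_zero {m n : ℕ} (hmn : m ≠ n)
    {G : Matrix (Fin (m + 1)) (Fin (n + 1)) ℂ} (hG : Intertwines (J m) G (J n)) : G = 0 := by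
  -- An intertwiner also intertwines the Casimirs, which are scalars differing by `(m - n)(m + n +
  -- 2)/4`.
  have h : (∑ a, J m a * J m a) * G = G * ∑ a, J n a * J n a := by
    rw [Matrix.sum_mul, Matrix.mul_sum]
    refine Finset.sum_congr rfl fun a _ => ?_
    rw [Matrix.mul_assoc, hG a, ← Matrix.mul_assoc, hG a, Matrix.mul_assoc]
  rw [casimir, casimir, Matrix.smul_mul, Matrix.mul_smul, Matrix.one_mul, Matrix.mul_one,
    ← sub_eq_zero, ← sub_smul] at h
  refine (smul_eq_zero.mp h).resolve_left ?_
  rw [← Complex.ofReal_sub]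
  norm_cast
  intro h0
  have h1 : ((m : ℝ) - n) * (m + n + 2) = 0 := by
    simp only [spin] at h0
    linarith
  rcases mul_eq_zero.mp h1 with h2 | h2
  · exact hmn (by exact_mod_cast sub_eq_zero.mp h2)
  · have : (0 : ℝ) < m + n + 2 := by positivity
    exact this.ne' h2

/-- Schur's lemma for a single spin. -/
theorem Intertwines.eq_smul_one {n : ℕ} {G : Op n} (hG : Intertwines (J n) G (J n)) :
    G = G (Fin.last n) (Fin.last n) • (1 : Op n) := by
  obtain ⟨hp, -, hz⟩ := intertwines_iff_ladder.mp hG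
  rw [J_plus] at hp
  -- The weights of `J^z` are distinct, so commuting with it forces a diagonal matrix.
  have hoff : ∀ i j, i ≠ j → G i j = 0 := by
    intro i j hij
    have := congrFun (congrFun hz i) j
    rw [J_two, Matrix.diagonal_mul, Matrix.mul_diagonal, mul_comm, ← sub_eq_zero, ← mul_sub] at this
    refine (mul_eq_zero.mp this).resolve_right ?_
    rw [← Complex.ofReal_sub]
    norm_cast
    rw [mag_eq, mag_eq]
    intro h
    apply hij
    have : ((i : ℕ) : ℝ) = (j : ℕ) := by linarith
    exact Fin.ext (by exact_mod_cast this)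
  -- The raising operator links neighbouring weights with nonzero entries, so the diagonal is
  -- constant.
  have hstep : ∀ i j : Fin (n + 1), (i : ℕ) = j + 1 → G i i = G j j := by
    intro i j hij
    have h := congrFun (congrFun hp i) j
    rw [Matrix.mul_apply, Matrix.mul_apply, Finset.sum_eq_single j, Finset.sum_eq_single i] at h
    · rw [mul_comm] at h
      refine (mul_right_cancel₀ ?_ h).symm
      simp only [Jplus, Matrix.map_apply, raising_apply, hij, if_true]
      norm_cast
      have : ((j : ℕ) : ℝ) < n := by exact_mod_cast (show (j : ℕ) < n by omega)
      have h2 : (0 : ℝ) < (((j : ℕ) : ℝ) + 1) * (n - (j : ℕ)) :=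
        mul_pos (by positivity) (by linarith)
      simpa using (Real.sqrt_pos.mpr h2).ne'
    · intro k _ hk
      rw [hoff i k hk.symm, zero_mul]
    · simp
    · intro k _ hk
      rw [hoff k j hk, mul_zero]
    · simp
  have hconst : ∀ d : ℕ, ∀ i : Fin (n + 1), (i : ℕ) + d = n → G i i = G (Fin.last n) (Fin.last n) := by
    intro d
    induction d with
    | zero =>
      intro i hi
      rw [show i = Fin.last n from Fin.ext (by simpa using hi)]
    | succ d ih =>
      intro i hi
      rw [← hstep ⟨i + 1, by omega⟩ i rfl]
      exact ih _ (by simp only; omega)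
  ext i j
  by_cases h : i = j
  · subst h
    simp [hconst (n - i) i (by omega)]
  · simp [h, hoff i j h]

end Intertwines

/-! ### Coupled states -/

section Coupled

/-- The operator `A ⊗ 1 + 1 ⊗ B`. -/
def kroneckerSum {R ι κ : Type*} [CommRing R] [DecidableEq ι] [DecidableEq κ]
    (A : Matrix ι ι R) (B : Matrix κ κ R) : Matrix (ι × κ) (ι × κ) R :=
  A ⊗ₖ 1 + 1 ⊗ₖ B

theorem kroneckerSum_apply_sum {R ι κ : Type*} [CommRing R] [DecidableEq ι] [DecidableEq κ]
    [Fintype ι] [Fintype κ] (A : Matrix ι ι R) (B : Matrix κ κ R) (x : ι × κ) (v : ι × κ → R) :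
    ∑ y, kroneckerSum A B x y * v y = ∑ i, A x.1 i * v (i, x.2) + ∑ j, B x.2 j * v (x.1, j) := by
  simp only [kroneckerSum, Matrix.add_apply, Matrix.kroneckerMap_apply, add_mul,
    Finset.sum_add_distrib, Fintype.sum_prod_type, Matrix.one_apply]
  congr 1
  · refine Finset.sum_congr rfl fun i _ => ?_
    simp
  · rw [Finset.sum_comm]
    refine Finset.sum_congr rfl fun i _ => ?_
    simp

theorem kroneckerSum_commutator {R ι κ : Type*} [CommRing R] [DecidableEq ι] [DecidableEq κ]
    [Fintype ι] [Fintype κ] (A A' : Matrix ι ι R) (B B' : Matrix κ κ R) :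
    kroneckerSum A B * kroneckerSum A' B' - kroneckerSum A' B' * kroneckerSum A B =
      kroneckerSum (A * A' - A' * A) (B * B' - B' * B) := by
  ext ⟨i, j⟩ ⟨i', j'⟩
  simp only [kroneckerSum, Matrix.add_mul, Matrix.mul_add, ← Matrix.mul_kronecker_mul,
    Matrix.one_mul, Matrix.mul_one, Matrix.sub_apply, Matrix.add_apply,
    Matrix.kroneckerMap_apply]
  ring

variable (n₁ n₂ n₃ : ℕ)

theorem totalLowering_eq : totalLowering n₁ n₂ = kroneckerSum (lowering n₁) (lowering n₂) := rfl

/-- The total raising operator. -/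
noncomputable def totalRaising : Matrix (Fin (n₁ + 1) × Fin (n₂ + 1)) (Fin (n₁ + 1) × Fin (n₂ + 1)) ℝ :=
  kroneckerSum (raising n₁) (raising n₂)

/-- The total weight operator. -/
noncomputable def totalWeight : Matrix (Fin (n₁ + 1) × Fin (n₂ + 1)) (Fin (n₁ + 1) × Fin (n₂ + 1)) ℝ :=
  kroneckerSum (weight n₁) (weight n₂)

theorem transpose_totalLowering : (totalLowering n₁ n₂)ᵀ = totalRaising n₁ n₂ := by
  ext ⟨i, j⟩ ⟨i', j'⟩
  simp [totalLowering, totalRaising, kroneckerSum, lowering, Matrix.one_apply, eq_comm]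

theorem totalRaising_mul_totalLowering :
    totalRaising n₁ n₂ * totalLowering n₁ n₂ =
      totalLowering n₁ n₂ * totalRaising n₁ n₂ + (2 : ℝ) • totalWeight n₁ n₂ := by
  refine eq_add_of_sub_eq' ?_
  rw [totalLowering_eq, totalRaising, kroneckerSum_commutator, raising_commutator,
    raising_commutator, totalWeight]
  ext
  simp [kroneckerSum]
  ring

theorem totalWeight_mul_totalLowering :
    totalWeight n₁ n₂ * totalLowering n₁ n₂ =
      totalLowering n₁ n₂ * totalWeight n₁ n₂ - totalLowering n₁ n₂ := by
  rw [eq_comm, sub_eq_iff_eq_add, ← sub_eq_iff_eq_add', ← neg_inj, neg_sub, totalLowering_eq,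
    totalWeight, kroneckerSum_commutator,
    weight_commutator_lowering, weight_commutator_lowering]
  ext
  simp [kroneckerSum]
  ring

theorem totalWeight_mulVec_highestWeight :
    totalWeight n₁ n₂ *ᵥ highestWeight n₁ n₂ n₃ = ((n₃ : ℝ) / 2) • highestWeight n₁ n₂ n₃ := by
  ext ⟨i, j⟩
  rw [Matrix.mulVec, dotProduct, totalWeight, kroneckerSum_apply_sum]
  simp only [weight, Matrix.diagonal_apply, ite_mul, zero_mul, Finset.sum_ite_eq,
    Finset.mem_univ, if_true, Pi.smul_apply, smul_eq_mul]
  by_cases h : twoM n₁ i + twoM n₂ j = n₃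
  · rw [← add_mul, mag, mag]
    congr 1
    have : ((twoM n₁ i : ℤ) : ℝ) + (twoM n₂ j : ℤ) = n₃ := by exact_mod_cast h
    linarith
  · simp [highestWeight, h]

/-- The magnitude of the components of the highest-weight vector. -/
noncomputable def hwCoeff (a b : ℕ) : ℝ :=
  if 2 * (a : ℤ) - n₁ + (2 * b - n₂) = n₃ then
    (-1) ^ (n₁ - a) * Real.sqrt ((a.factorial * b.factorial : ℝ) /
      ((n₁ - a).factorial * (n₂ - b).factorial : ℝ)) else 0

theorem highestWeight_eq (x : Fin (n₁ + 1) × Fin (n₂ + 1)) :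
    highestWeight n₁ n₂ n₃ x = hwCoeff n₁ n₂ n₃ x.1 x.2 := rfl

variable {n₁ n₂ n₃}

/-- The squared ladder coefficient is exactly the ratio of consecutive values of `a! / (n-a)!`. Both
the highest-weight components and the ladder normalisation rest on this. -/
theorem factorial_ratio_step {n a : ℕ} (ha : a < n) (c : ℝ) :
    ((a : ℝ) + 1) * (n - a) * ((a.factorial : ℝ) / (n - a).factorial * c) =
      ((a + 1).factorial : ℝ) / (n - (a + 1)).factorial * c := by
  obtain ⟨d, rfl⟩ : ∃ d, n = a + d + 1 := ⟨n - a - 1, by omega⟩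
  rw [show a + d + 1 - a = d + 1 by omega, show a + d + 1 - (a + 1) = d by omega,
    Nat.factorial_succ, Nat.factorial_succ]
  have : ((d.factorial : ℕ) : ℝ) ≠ 0 := by exact_mod_cast d.factorial_ne_zero
  push_cast
  field_simp
  ring

/-- Each component receives one term from raising either factor. The factorial weights give them
equal size and the alternating sign makes them cancel. The triangle inequalities exclude the
boundary components that would receive a single term. -/
theorem totalRaising_mulVec_highestWeight (h₁ : n₁ ≤ n₂ + n₃) (h₂ : n₂ ≤ n₁ + n₃) :
    totalRaising n₁ n₂ *ᵥ highestWeight n₁ n₂ n₃ = 0 := by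
  ext ⟨⟨i, hi⟩, ⟨j, hj⟩⟩
  rw [Matrix.mulVec, dotProduct, totalRaising, kroneckerSum_apply_sum]
  simp only [highestWeight_eq, Pi.zero_apply]
  rw [sum_raising_mul n₁ (fun a => hwCoeff n₁ n₂ n₃ a j),
    sum_raising_mul n₂ (fun b => hwCoeff n₁ n₂ n₃ i b)]
  simp only
  rcases i with _ | i
  · rcases j with _ | j
    · simp
    · rw [Nat.add_sub_cancel, hwCoeff, hwCoeff,
        if_neg (c := 2 * ((0 : ℕ) : ℤ) - n₁ + (2 * (j : ℤ) - n₂) = n₃) (by omega)]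
      simp
  · rcases j with _ | j
    · rw [Nat.add_sub_cancel, hwCoeff, hwCoeff,
        if_neg (c := 2 * (i : ℤ) - n₁ + (2 * ((0 : ℕ) : ℤ) - n₂) = n₃) (by omega)]
      simp
    · simp only [Nat.add_sub_cancel, hwCoeff]
      by_cases h : 2 * (i : ℤ) - n₁ + (2 * ((j + 1 : ℕ) : ℤ) - n₂) = n₃
      · have h' : 2 * ((i + 1 : ℕ) : ℤ) - n₁ + (2 * (j : ℤ) - n₂) = n₃ := by
          push_cast at h ⊢
          linarith
        rw [if_pos h, if_pos h', show n₁ - i = n₁ - (i + 1) + 1 by omega, pow_succ]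
        have e1 : Real.sqrt (((i + 1 : ℕ) : ℝ) * (n₁ + 1 - ((i + 1 : ℕ) : ℝ))) *
            Real.sqrt ((i.factorial * (j + 1).factorial : ℝ) /
              ((n₁ - (i + 1) + 1).factorial * (n₂ - (j + 1)).factorial : ℝ)) =
            Real.sqrt (((i + 1).factorial * (j + 1).factorial : ℝ) /
              ((n₁ - (i + 1)).factorial * (n₂ - (j + 1)).factorial : ℝ)) := by
          rw [← Real.sqrt_mul]
          · congr 1
            have := factorial_ratio_step (show i < n₁ by omega)
              (((j + 1).factorial : ℝ) / (n₂ - (j + 1)).factorial)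
            rw [div_mul_div_comm, div_mul_div_comm] at this
            rw [← this, show n₁ - i = n₁ - (i + 1) + 1 by omega]
            push_cast
            ring
          · have : (i : ℝ) + 1 ≤ n₁ := by exact_mod_cast (show i + 1 ≤ n₁ by omega)
            push_cast
            exact mul_nonneg (by positivity) (by linarith)
        have e2 : Real.sqrt (((j + 1 : ℕ) : ℝ) * (n₂ + 1 - ((j + 1 : ℕ) : ℝ))) *
            Real.sqrt (((i + 1).factorial * j.factorial : ℝ) /
              ((n₁ - (i + 1)).factorial * (n₂ - j).factorial : ℝ)) =
            Real.sqrt (((i + 1).factorial * (j + 1).factorial : ℝ) /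
              ((n₁ - (i + 1)).factorial * (n₂ - (j + 1)).factorial : ℝ)) := by
          rw [← Real.sqrt_mul]
          · congr 1
            have := factorial_ratio_step (show j < n₂ by omega)
              (((i + 1).factorial : ℝ) / (n₁ - (i + 1)).factorial)
            rw [div_mul_div_comm, div_mul_div_comm] at this
            rw [mul_comm ((i + 1).factorial : ℝ), mul_comm ((i + 1).factorial : ℝ),
              mul_comm ((n₁ - (i + 1)).factorial : ℝ), mul_comm ((n₁ - (i + 1)).factorial : ℝ),
              ← this]
            push_cast
            ring
          · have : (j : ℝ) + 1 ≤ n₂ := by exact_mod_cast (show j + 1 ≤ n₂ by omega)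
            push_cast
            exact mul_nonneg (by positivity) (by linarith)
        linear_combination -(-1) ^ (n₁ - (i + 1)) * e1 + (-1) ^ (n₁ - (i + 1)) * e2
      · have h' : ¬ (2 * ((i + 1 : ℕ) : ℤ) - n₁ + (2 * (j : ℤ) - n₂) = n₃) := by
          push_cast at h ⊢
          intro h2
          apply h
          linarith
        rw [if_neg h, if_neg h']
        simp

variable (n₁ n₂ n₃) in
/-- The vectors `(J₋)^k |J,J⟩` (unnormalised). -/
noncomputable def descent (k : ℕ) : Fin (n₁ + 1) × Fin (n₂ + 1) → ℝ :=
  (totalLowering n₁ n₂ ^ k) *ᵥ highestWeight n₁ n₂ n₃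

theorem totalLowering_mulVec_descent (k : ℕ) :
    totalLowering n₁ n₂ *ᵥ descent n₁ n₂ n₃ k = descent n₁ n₂ n₃ (k + 1) := by
  rw [descent, descent, Matrix.mulVec_mulVec, pow_succ']

theorem totalWeight_mulVec_descent (k : ℕ) :
    totalWeight n₁ n₂ *ᵥ descent n₁ n₂ n₃ k = ((n₃ : ℝ) / 2 - k) • descent n₁ n₂ n₃ k := by
  induction k with
  | zero => simpa [descent] using totalWeight_mulVec_highestWeight n₁ n₂ n₃
  | succ k ih =>
    rw [← totalLowering_mulVec_descent, Matrix.mulVec_mulVec, totalWeight_mul_totalLowering,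
      Matrix.sub_mulVec, ← Matrix.mulVec_mulVec, ih, Matrix.mulVec_smul]
    push_cast
    module

/-- Commuting `J₊` past one more `J₋` adds twice the weight, and `∑_{i ≤ k} (2J - 2i) =
(k+1)(2J-k)`. -/
theorem totalRaising_mulVec_descent (h₁ : n₁ ≤ n₂ + n₃) (h₂ : n₂ ≤ n₁ + n₃) (k : ℕ) :
    totalRaising n₁ n₂ *ᵥ descent n₁ n₂ n₃ (k + 1) =
      (((k : ℝ) + 1) * (n₃ - k)) • descent n₁ n₂ n₃ k := by
  induction k with
  | zero =>
    rw [← totalLowering_mulVec_descent, Matrix.mulVec_mulVec, totalRaising_mul_totalLowering,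
      Matrix.add_mulVec, ← Matrix.mulVec_mulVec, Matrix.smul_mulVec,
      totalWeight_mulVec_descent]
    have : totalRaising n₁ n₂ *ᵥ descent n₁ n₂ n₃ 0 = 0 := by
      simpa [descent] using totalRaising_mulVec_highestWeight h₁ h₂
    rw [this, Matrix.mulVec_zero]
    push_cast
    module
  | succ k ih =>
    rw [← totalLowering_mulVec_descent, Matrix.mulVec_mulVec, totalRaising_mul_totalLowering,
      Matrix.add_mulVec, ← Matrix.mulVec_mulVec, Matrix.smul_mulVec,
      totalWeight_mulVec_descent, ih, Matrix.mulVec_smul, totalLowering_mulVec_descent]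
    push_cast
    module

/-- The squared norm equals `⟨v, J₊J₋v⟩` with `v` the previous vector, and the coefficient of `J₊`
at this step contains the factor `n₃ - n₃`. -/
theorem descent_eq_zero (h₁ : n₁ ≤ n₂ + n₃) (h₂ : n₂ ≤ n₁ + n₃) :
    descent n₁ n₂ n₃ (n₃ + 1) = 0 := by
  rw [← dotProduct_self_eq_zero]
  nth_rewrite 1 [← totalLowering_mulVec_descent]
  rw [dotProduct_comm, Matrix.dotProduct_mulVec, ← Matrix.mulVec_transpose,
    transpose_totalLowering, totalRaising_mulVec_descent h₁ h₂]
  simp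

variable (n₁ n₂ n₃) in
/-- The matrix whose columns are the coupled states. -/
noncomputable def coupledMatrix : Matrix (Fin (n₁ + 1) × Fin (n₂ + 1)) (Fin (n₃ + 1)) ℝ :=
  Matrix.of fun x c => coupledState n₁ n₂ n₃ c x

variable (n₁ n₂ n₃) in
/-- The norm of the highest-weight vector. -/
noncomputable def hwNorm : ℝ := Real.sqrt (∑ x, highestWeight n₁ n₂ n₃ x ^ 2)

/-- The ladder normalisation `√((J+M)! / ((2J)! (J-M)!))`. -/
noncomputable def ladderNorm (n c : ℕ) : ℝ :=
  Real.sqrt ((c.factorial : ℝ) / (n.factorial * (n - c).factorial : ℝ))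

theorem coupledState_eq (c : Fin (n₃ + 1)) : coupledState n₁ n₂ n₃ c =
    (ladderNorm n₃ c / hwNorm n₁ n₂ n₃) • descent n₁ n₂ n₃ (n₃ - (c : ℕ)) := rfl

theorem ladderNorm_succ {n c : ℕ} (hc : c < n) :
    ladderNorm n (c + 1) = Real.sqrt (((c : ℝ) + 1) * (n - c)) * ladderNorm n c := by
  have h : (c : ℝ) + 1 ≤ n := by exact_mod_cast hc
  rw [ladderNorm, ladderNorm, ← Real.sqrt_mul (mul_nonneg (by positivity) (by linarith))]
  congr 1
  have := factorial_ratio_step hc (1 / (n.factorial : ℝ))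
  rw [div_mul_div_comm, div_mul_div_comm, mul_one, mul_one] at this
  rw [mul_comm (n.factorial : ℝ), mul_comm (n.factorial : ℝ), this]

theorem totalLowering_mul_coupledMatrix (h₁ : n₁ ≤ n₂ + n₃) (h₂ : n₂ ≤ n₁ + n₃) :
    totalLowering n₁ n₂ * coupledMatrix n₁ n₂ n₃ = coupledMatrix n₁ n₂ n₃ * lowering n₃ := by
  ext x c
  have hr : (coupledMatrix n₁ n₂ n₃ * lowering n₃) x c =
      ∑ c', raising n₃ c c' *
        (fun d : ℕ => (ladderNorm n₃ d / hwNorm n₁ n₂ n₃) * descent n₁ n₂ n₃ (n₃ - d) x) c' := by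
    rw [Matrix.mul_apply]
    refine Finset.sum_congr rfl fun c' _ => ?_
    rw [mul_comm]
    rfl
  have hl : (totalLowering n₁ n₂ * coupledMatrix n₁ n₂ n₃) x c =
      (totalLowering n₁ n₂ *ᵥ coupledState n₁ n₂ n₃ c) x := rfl
  rw [hr, hl, sum_raising_mul n₃ (fun d : ℕ => (ladderNorm n₃ d / hwNorm n₁ n₂ n₃) *
    descent n₁ n₂ n₃ (n₃ - d) x), coupledState_eq, Matrix.mulVec_smul,
    totalLowering_mulVec_descent, Pi.smul_apply, smul_eq_mul]
  obtain ⟨c, hc⟩ := c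
  rcases c with _ | c
  -- At the bottom of the ladder, `J₋` has to annihilate `|J,-J⟩`.
  · simp [descent_eq_zero h₁ h₂]
  · simp only [Nat.add_sub_cancel]
    rw [show n₃ - (c + 1) + 1 = n₃ - c by omega, ladderNorm_succ (by omega)]
    rw [show ((n₃ : ℝ) + 1 - ((c + 1 : ℕ) : ℝ)) = n₃ - c by push_cast; ring]
    push_cast
    ring

theorem totalRaising_mul_coupledMatrix (h₁ : n₁ ≤ n₂ + n₃) (h₂ : n₂ ≤ n₁ + n₃) :
    totalRaising n₁ n₂ * coupledMatrix n₁ n₂ n₃ = coupledMatrix n₁ n₂ n₃ * raising n₃ := by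
  ext x c
  have hr : (coupledMatrix n₁ n₂ n₃ * raising n₃) x c =
      ∑ c', lowering n₃ c c' *
        (fun d : ℕ => (ladderNorm n₃ d / hwNorm n₁ n₂ n₃) * descent n₁ n₂ n₃ (n₃ - d) x) c' := by
    rw [Matrix.mul_apply]
    refine Finset.sum_congr rfl fun c' _ => ?_
    rw [mul_comm]
    rfl
  have hl : (totalRaising n₁ n₂ * coupledMatrix n₁ n₂ n₃) x c =
      (totalRaising n₁ n₂ *ᵥ coupledState n₁ n₂ n₃ c) x := rfl
  rw [hr, hl, sum_lowering_mul n₃ (fun d : ℕ => (ladderNorm n₃ d / hwNorm n₁ n₂ n₃) *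
    descent n₁ n₂ n₃ (n₃ - d) x), coupledState_eq, Matrix.mulVec_smul, Pi.smul_apply,
    smul_eq_mul]
  obtain ⟨c, hc⟩ := c
  by_cases hcn : c = n₃
  · subst hcn
    have : totalRaising n₁ n₂ *ᵥ descent n₁ n₂ c 0 = 0 := by
      simpa [descent] using totalRaising_mulVec_highestWeight h₁ h₂
    simp [this]
  · simp only
    have h0 : (0 : ℝ) ≤ ((c : ℝ) + 1) * (n₃ - c) := by
      have : (c : ℝ) ≤ n₃ := by exact_mod_cast (show c ≤ n₃ by omega)
      exact mul_nonneg (by positivity) (by linarith)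
    rw [ladderNorm_succ (by omega), show n₃ - c = n₃ - (c + 1) + 1 by omega,
      totalRaising_mulVec_descent h₁ h₂, Pi.smul_apply, smul_eq_mul]
    rw [Nat.cast_sub (show c + 1 ≤ n₃ by omega)]
    have h3 := Real.mul_self_sqrt h0
    push_cast
    linear_combination -(ladderNorm n₃ c / hwNorm n₁ n₂ n₃ *
      descent n₁ n₂ n₃ (n₃ - (c + 1)) x) * h3

theorem totalWeight_mul_coupledMatrix :
    totalWeight n₁ n₂ * coupledMatrix n₁ n₂ n₃ = coupledMatrix n₁ n₂ n₃ * weight n₃ := by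
  ext x c
  have hl : (totalWeight n₁ n₂ * coupledMatrix n₁ n₂ n₃) x c =
      (totalWeight n₁ n₂ *ᵥ coupledState n₁ n₂ n₃ c) x := rfl
  rw [hl, weight, Matrix.mul_diagonal, coupledState_eq, Matrix.mulVec_smul,
    totalWeight_mulVec_descent, coupledMatrix, Matrix.of_apply, coupledState_eq, mag_eq,
    Nat.cast_sub (show (c : ℕ) ≤ n₃ by omega)]
  simp only [Pi.smul_apply, smul_eq_mul]
  ring

/-- This is the component `m₁ = j₁`, `m₂ = J - j₁`, the one made positive by the Condon–Shortley
convention. -/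
theorem highestWeight_ne_zero (b : Fin (n₂ + 1)) (hb : 2 * (b : ℕ) + n₁ = n₂ + n₃) :
    highestWeight n₁ n₂ n₃ (Fin.last n₁, b) ≠ 0 := by
  rw [highestWeight, if_pos]
  · refine mul_ne_zero (by simp) (Real.sqrt_pos.mpr ?_).ne'
    have := Nat.factorial_pos
    simp only [Fin.val_last]
    have h1 := this n₁
    have h2 := this b
    have h3 := this (n₁ - n₁)
    have h4 := this (n₂ - b)
    positivity
  · simp only [twoM, Fin.val_last]
    omega

theorem hwNorm_pos (h₁ : n₁ ≤ n₂ + n₃) (h₃ : n₃ ≤ n₁ + n₂)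
    (hp : Even (n₁ + n₂ + n₃)) : 0 < hwNorm n₁ n₂ n₃ := by
  -- The index of `m₂ = J - j₁`; the parity assumption makes the division exact.
  have hb : (n₂ + n₃ - n₁) / 2 < n₂ + 1 := by omega
  have h := highestWeight_ne_zero (n₁ := n₁) (n₃ := n₃) ⟨(n₂ + n₃ - n₁) / 2, hb⟩ (by
    obtain ⟨r, hr⟩ := hp
    simp only
    omega)
  refine Real.sqrt_pos.mpr (Finset.sum_pos' (fun x _ => sq_nonneg _)
    ⟨(Fin.last n₁, ⟨(n₂ + n₃ - n₁) / 2, hb⟩), Finset.mem_univ _, ?_⟩)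
  exact sq_pos_of_ne_zero h

theorem coupledState_last : coupledState n₁ n₂ n₃ (Fin.last n₃) =
    (1 / hwNorm n₁ n₂ n₃) • highestWeight n₁ n₂ n₃ := by
  rw [coupledState_eq]
  have : ladderNorm n₃ n₃ = 1 := by
    rw [ladderNorm]
    simp [Nat.factorial_ne_zero]
  simp [this, descent]

variable (n₁ n₂ n₃) in
/-- The complexified matrix of coupled states. -/
noncomputable def coupling : Matrix (Fin (n₁ + 1) × Fin (n₂ + 1)) (Fin (n₃ + 1)) ℂ :=
  (coupledMatrix n₁ n₂ n₃).map (fun x : ℝ => (x : ℂ))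

theorem kroneckerSum_map (A : Matrix (Fin (n₁ + 1)) (Fin (n₁ + 1)) ℝ)
    (B : Matrix (Fin (n₂ + 1)) (Fin (n₂ + 1)) ℝ) :
    (kroneckerSum A B).map (fun x : ℝ => (x : ℂ)) =
      kroneckerSum (A.map (fun x : ℝ => (x : ℂ))) (B.map (fun x : ℝ => (x : ℂ))) := by
  ext ⟨i, j⟩ ⟨i', j'⟩
  simp [kroneckerSum, Matrix.one_apply, apply_ite (fun x : ℝ => (x : ℂ))]

theorem kroneckerSum_add_smul (A A' : Op n₁) (B B' : Op n₂) (c : ℂ) :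
    kroneckerSum A B + c • kroneckerSum A' B' = kroneckerSum (A + c • A') (B + c • B') := by
  ext ⟨i, j⟩ ⟨i', j'⟩
  simp only [kroneckerSum, Matrix.add_apply, Matrix.smul_apply, Matrix.kroneckerMap_apply,
    smul_eq_mul]
  ring

theorem coupling_intertwines (h₁ : n₁ ≤ n₂ + n₃) (h₂ : n₂ ≤ n₁ + n₃) :
    Intertwines (fun a => kroneckerSum (J n₁ a) (J n₂ a)) (coupling n₁ n₂ n₃) (J n₃) := by
  rw [intertwines_iff_ladder, J_plus, J_minus, J_two', J_two', J_two']
  refine ⟨?_, ?_, ?_⟩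
  · rw [kroneckerSum_add_smul, J_plus, J_plus, Jplus, Jplus, Jplus, ← kroneckerSum_map, coupling,
      ← map_ofReal_mul, ← map_ofReal_mul, ← totalRaising_mul_coupledMatrix h₁ h₂, totalRaising]
  · rw [sub_eq_add_neg, ← neg_smul, kroneckerSum_add_smul, neg_smul, neg_smul, ← sub_eq_add_neg,
      ← sub_eq_add_neg, J_minus, J_minus, Jminus, Jminus, Jminus, ← kroneckerSum_map, coupling,
      ← map_ofReal_mul, ← map_ofReal_mul, ← totalLowering_mul_coupledMatrix h₁ h₂,
      totalLowering_eq]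
  · rw [← kroneckerSum_map, coupling, ← map_ofReal_mul, ← map_ofReal_mul,
      ← totalWeight_mul_coupledMatrix, totalWeight]

theorem kroneckerSum_isHermitian {A : Op n₁} {B : Op n₂} (hA : Aᴴ = A) (hB : Bᴴ = B) :
    (kroneckerSum A B)ᴴ = kroneckerSum A B := by
  rw [kroneckerSum, Matrix.conjTranspose_add, Matrix.conjTranspose_kronecker,
    Matrix.conjTranspose_kronecker, hA, hB, Matrix.conjTranspose_one, Matrix.conjTranspose_one]

/-- The coupled states are orthonormal. -/
theorem coupling_orthonormal (h₁ : n₁ ≤ n₂ + n₃) (h₂ : n₂ ≤ n₁ + n₃) (h₃ : n₃ ≤ n₁ + n₂)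
    (hp : Even (n₁ + n₂ + n₃)) : (coupling n₁ n₂ n₃)ᴴ * coupling n₁ n₂ n₃ = 1 := by
  have h := coupling_intertwines (n₃ := n₃) h₁ h₂
  have h' := h.conjTranspose
    (fun a => kroneckerSum_isHermitian (J_isHermitian n₁ a) (J_isHermitian n₂ a))
    (J_isHermitian n₃)
  -- The Gram matrix commutes with the irrep, so it is scalar by Schur's lemma. Only the norm of the
  -- highest-weight vector remains to be computed.
  rw [(h'.comp h).eq_smul_one]
  convert! one_smul ℂ (1 : Op n₃)
  have hn := hwNorm_pos h₁ h₃ hp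
  have hs : hwNorm n₁ n₂ n₃ ^ 2 = ∑ x, highestWeight n₁ n₂ n₃ x ^ 2 :=
    Real.sq_sqrt (Finset.sum_nonneg fun x _ => sq_nonneg _)
  simp only [Matrix.mul_apply, Matrix.conjTranspose_apply, coupling, Matrix.map_apply,
    coupledMatrix, Matrix.of_apply, coupledState_last, Pi.smul_apply, smul_eq_mul,
    RCLike.star_def, Complex.conj_ofReal]
  norm_cast
  have : ∀ x, 1 / hwNorm n₁ n₂ n₃ * highestWeight n₁ n₂ n₃ x *
      (1 / hwNorm n₁ n₂ n₃ * highestWeight n₁ n₂ n₃ x) =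
      highestWeight n₁ n₂ n₃ x ^ 2 / hwNorm n₁ n₂ n₃ ^ 2 := fun x => by
    field_simp
  simp only [this]
  rw [← Finset.sum_div, ← hs, div_self (by positivity)]

theorem cg_eq (h₁ : n₁ ≤ n₂ + n₃) (h₂ : n₂ ≤ n₁ + n₃) (h₃ : n₃ ≤ n₁ + n₂)
    (a : Fin (n₁ + 1)) (b : Fin (n₂ + 1)) (c : Fin (n₃ + 1)) :
    cg n₁ (twoM n₁ a) n₂ (twoM n₂ b) n₃ (twoM n₃ c) = coupledState n₁ n₂ n₃ c (a, b) := by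
  have hinj : ∀ (n : ℕ) (i j : Fin (n + 1)), twoM n i = twoM n j ↔ i = j := by
    intro n i j
    rw [twoM, twoM, Fin.ext_iff]
    omega
  rw [cg, if_pos ⟨h₁, h₂, h₃⟩]
  simp only [hinj]
  rw [Finset.sum_eq_single a, Finset.sum_eq_single b, Finset.sum_eq_single c]
  · simp
  · intro x _ hx
    simp [hx]
  · simp
  · intro x _ hx
    simp [hx]
  · simp
  · intro x _ hx
    simp [hx]
  · simp

end Coupled

/-! ### From the Lie algebra to the group -/

section Exponential

open scoped Matrix.Norms.Operator

variable {ι κ : Type*} [Fintype ι] [Fintype κ] [DecidableEq ι] [DecidableEq κ]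

/-- The operator `exp (i 𝒜·v)`. -/
noncomputable def rotation (𝒜 : Fin 3 → Matrix ι ι ℂ) (v : Fin 3 → ℝ) : Matrix ι ι ℂ :=
  NormedSpace.exp (Complex.I • ∑ a, (v a : ℂ) • 𝒜 a)

theorem U_eq_rotation (n : ℕ) : U n = rotation (J n) := rfl

/-- The relation passes to powers, and multiplication by `F` is continuous, so it passes to the
exponential series. -/
theorem exp_mul_of_intertwines {X : Matrix ι ι ℂ} {Y : Matrix κ κ ℂ} {F : Matrix ι κ ℂ}
    (h : X * F = F * Y) : NormedSpace.exp X * F = F * NormedSpace.exp Y := by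
  have hpow : ∀ n : ℕ, X ^ n * F = F * Y ^ n := by
    intro n
    induction n with
    | zero => simp
    | succ n ih => rw [pow_succ', Matrix.mul_assoc, ih, ← Matrix.mul_assoc, h, Matrix.mul_assoc,
        ← pow_succ']
  have h1 := NormedSpace.exp_series_hasSum_exp' (𝕂 := ℂ) X
  have h2 := NormedSpace.exp_series_hasSum_exp' (𝕂 := ℂ) Y
  have h1' : HasSum (fun n : ℕ => ((n.factorial : ℂ)⁻¹ • X ^ n) * F) (NormedSpace.exp X * F) :=
    h1.map (Matrix.addMonoidHomMulRight F) (by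
      change Continuous fun M : Matrix ι ι ℂ => M * F
      exact continuous_id.matrix_mul continuous_const)
  have h2' : HasSum (fun n : ℕ => F * ((n.factorial : ℂ)⁻¹ • Y ^ n)) (F * NormedSpace.exp Y) :=
    h2.map (Matrix.addMonoidHomMulLeft F) (by
      change Continuous fun M : Matrix κ κ ℂ => F * M
      exact continuous_const.matrix_mul continuous_id)
  refine h1'.unique ?_
  convert h2' using 2 with n
  rw [Matrix.smul_mul, Matrix.mul_smul, hpow]

theorem Intertwines.rotation {𝒜 : Fin 3 → Matrix ι ι ℂ} {F : Matrix ι κ ℂ}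
    {ℬ : Fin 3 → Matrix κ κ ℂ} (h : Intertwines 𝒜 F ℬ) (v : Fin 3 → ℝ) :
    rotation 𝒜 v * F = F * rotation ℬ v := by
  refine exp_mul_of_intertwines ?_
  rw [Matrix.smul_mul, Matrix.mul_smul, Matrix.sum_mul, Matrix.mul_sum]
  congr 1
  refine Finset.sum_congr rfl fun a _ => ?_
  rw [Matrix.smul_mul, Matrix.mul_smul, h a]

theorem hasDerivAt_exp_smul_apply (X : Matrix ι ι ℂ) (i j : ι) :
    HasDerivAt (fun t : ℝ => NormedSpace.exp (t • X) i j) (X i j) 0 := by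
  have h : HasDerivAt (fun t : ℝ => NormedSpace.exp (t • X)) X 0 := by
    have h0 := hasDerivAt_exp_smul_const X (0 : ℝ)
    rw [zero_smul, NormedSpace.exp_zero, one_mul] at h0
    exact h0
  have h2 := (LinearMap.toContinuousLinearMap
    ((Matrix.entryLinearMap ℝ ℂ i j))).hasFDerivAt.comp_hasDerivAt (0 : ℝ) h
  exact h2

theorem rotation_single (𝒜 : Fin 3 → Matrix ι ι ℂ) (a : Fin 3) (t : ℝ) :
    rotation 𝒜 (Pi.single a t) = NormedSpace.exp (t • (Complex.I • 𝒜 a)) := by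
  rw [rotation]
  congr 1
  rw [Finset.sum_eq_single a]
  · rw [Pi.single_eq_same, smul_comm]
    rfl
  · intro b _ hb
    simp [Pi.single_eq_of_ne hb]
  · simp

/-- Differentiate the group relation entrywise at `t = 0` along the rotations about axis `a`. -/
theorem intertwines_of_rotation {𝒜 : Fin 3 → Matrix ι ι ℂ} {F : Matrix ι κ ℂ}
    {ℬ : Fin 3 → Matrix κ κ ℂ} (h : ∀ v, rotation 𝒜 v * F = F * rotation ℬ v) :
    Intertwines 𝒜 F ℬ := by
  intro a
  have h1 : (Complex.I • 𝒜 a) * F = F * (Complex.I • ℬ a) := by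
    ext i j
    have e1 : HasDerivAt (fun t : ℝ => (NormedSpace.exp (t • (Complex.I • 𝒜 a)) * F) i j)
        (((Complex.I • 𝒜 a) * F) i j) 0 := by
      simp only [Matrix.mul_apply]
      exact HasDerivAt.fun_sum fun k _ => (hasDerivAt_exp_smul_apply _ i k).mul_const _
    have e2 : HasDerivAt (fun t : ℝ => (F * NormedSpace.exp (t • (Complex.I • ℬ a))) i j)
        ((F * (Complex.I • ℬ a)) i j) 0 := by
      simp only [Matrix.mul_apply]
      exact HasDerivAt.fun_sum fun k _ => (hasDerivAt_exp_smul_apply _ k j).const_mul _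
    have e : (fun t : ℝ => (NormedSpace.exp (t • (Complex.I • 𝒜 a)) * F) i j) =
        fun t : ℝ => (F * NormedSpace.exp (t • (Complex.I • ℬ a))) i j := by
      funext t
      rw [← rotation_single, ← rotation_single, h]
    rw [e] at e1
    exact e1.unique e2
  rw [Matrix.smul_mul, Matrix.mul_smul] at h1
  exact smul_right_injective _ Complex.I_ne_zero h1

/-- `A ↦ A ⊗ 1` is a continuous ring homomorphism, and these commute with `exp`. -/
theorem exp_kronecker_one (A : Matrix ι ι ℂ) :
    NormedSpace.exp (A ⊗ₖ (1 : Matrix κ κ ℂ)) = NormedSpace.exp A ⊗ₖ (1 : Matrix κ κ ℂ) := by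
  let f : Matrix ι ι ℂ →+* Matrix (ι × κ) (ι × κ) ℂ :=
    { toFun := fun A => A ⊗ₖ (1 : Matrix κ κ ℂ)
      map_one' := by simp
      map_mul' := fun A B => by rw [← Matrix.mul_kronecker_mul, one_mul]
      map_zero' := by simp
      map_add' := fun A B => Matrix.add_kronecker A B 1 }
  have hf : Continuous f := by
    refine continuous_matrix fun i j => ?_
    change Continuous fun A : Matrix ι ι ℂ => A i.1 j.1 * (1 : Matrix κ κ ℂ) i.2 j.2
    exact (continuous_id.matrix_elem _ _).mul continuous_const
  exact (NormedSpace.map_exp f hf A).symm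

theorem exp_one_kronecker (B : Matrix κ κ ℂ) :
    NormedSpace.exp ((1 : Matrix ι ι ℂ) ⊗ₖ B) = (1 : Matrix ι ι ℂ) ⊗ₖ NormedSpace.exp B := by
  let f : Matrix κ κ ℂ →+* Matrix (ι × κ) (ι × κ) ℂ :=
    { toFun := fun B => (1 : Matrix ι ι ℂ) ⊗ₖ B
      map_one' := by simp
      map_mul' := fun A B => by rw [← Matrix.mul_kronecker_mul, one_mul]
      map_zero' := by simp
      map_add' := fun A B => Matrix.kronecker_add 1 A B }
  have hf : Continuous f := by
    refine continuous_matrix fun i j => ?_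
    change Continuous fun B : Matrix κ κ ℂ => (1 : Matrix ι ι ℂ) i.1 j.1 * B i.2 j.2
    exact continuous_const.mul (continuous_id.matrix_elem _ _)
  exact (NormedSpace.map_exp f hf B).symm

theorem exp_kroneckerSum (A : Matrix ι ι ℂ) (B : Matrix κ κ ℂ) :
    NormedSpace.exp (kroneckerSum A B) = NormedSpace.exp A ⊗ₖ NormedSpace.exp B := by
  rw [kroneckerSum, Matrix.exp_add_of_commute, exp_kronecker_one, exp_one_kronecker,
    ← Matrix.mul_kronecker_mul, one_mul, mul_one]
  rw [commute_iff_eq, ← Matrix.mul_kronecker_mul, ← Matrix.mul_kronecker_mul]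
  simp

end Exponential

/-- The generators of `U_B ⊗ U_A^*`. -/
noncomputable def tensorGen (nA nB : ℕ) (a : Fin 3) :
    Matrix (Fin (nB + 1) × Fin (nA + 1)) (Fin (nB + 1) × Fin (nA + 1)) ℂ :=
  kroneckerSum (J nB a) (-(J nA a)ᵀ)

theorem tensorGen_isHermitian (nA nB : ℕ) (a : Fin 3) :
    (tensorGen nA nB a)ᴴ = tensorGen nA nB a := by
  refine kroneckerSum_isHermitian (J_isHermitian nB a) ?_
  rw [Matrix.conjTranspose_neg]
  congr 1
  exact congrArg Matrix.transpose (J_isHermitian nA a)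

theorem U_conjTranspose (n : ℕ) (v : Fin 3 → ℝ) :
    (U n v)ᴴ = NormedSpace.exp (-(Complex.I • ∑ a, (v a : ℂ) • J n a)) := by
  rw [U, ← Matrix.exp_conjTranspose, Matrix.conjTranspose_smul, Matrix.conjTranspose_sum,
    ← neg_smul]
  congr 2
  · simp
  · refine Finset.sum_congr rfl fun a _ => ?_
    rw [Matrix.conjTranspose_smul, J_isHermitian]
    simp

theorem U_mul_conjTranspose (n : ℕ) (v : Fin 3 → ℝ) : U n v * (U n v)ᴴ = 1 := by
  rw [U_conjTranspose, U, ← Matrix.exp_add_of_commute]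
  · simp
  · exact (Commute.refl _).neg_right

theorem conjTranspose_mul_U (n : ℕ) (v : Fin 3 → ℝ) : (U n v)ᴴ * U n v = 1 :=
  mul_eq_one_comm.mp (U_mul_conjTranspose n v)

/-- The conjugate of `U_A` is the transpose of its adjoint, hence `exp(i(-Jᵀ)·v)`, and `exp` turns
the Kronecker sum of the generators into a Kronecker product. -/
theorem tensorRep_eq_rotation (nA nB : ℕ) : tensorRep nA nB = rotation (tensorGen nA nB) := by
  funext v
  have h1 : (U nA v).map (starRingEnd ℂ) = ((U nA v)ᴴ)ᵀ := rfl
  have h2 : Complex.I • ∑ a, (v a : ℂ) • tensorGen nA nB a =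
      kroneckerSum (Complex.I • ∑ a, (v a : ℂ) • J nB a)
        (-(Complex.I • ∑ a, (v a : ℂ) • J nA a))ᵀ := by
    ext ⟨i, j⟩ ⟨i', j'⟩
    simp only [tensorGen, kroneckerSum, Fin.sum_univ_three, Matrix.add_apply, Matrix.smul_apply,
      Matrix.kroneckerMap_apply, Matrix.transpose_apply, Matrix.neg_apply, smul_eq_mul]
    ring
  rw [tensorRep, rotation, h1, U_conjTranspose, h2, exp_kroneckerSum, U, Matrix.exp_transpose]

theorem tensorRep_mul_iff {nA nB : ℕ} {κ : Type*} [Fintype κ] [DecidableEq κ]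
    {F : Matrix (Fin (nB + 1) × Fin (nA + 1)) κ ℂ} {ℬ : Fin 3 → Matrix κ κ ℂ} :
    (∀ v, tensorRep nA nB v * F = F * rotation ℬ v) ↔ Intertwines (tensorGen nA nB) F ℬ := by
  rw [tensorRep_eq_rotation]
  exact ⟨intertwines_of_rotation, fun h => h.rotation⟩

/-- The matrix whose columns are the vectorisations of the `V k`. -/
def vectorize {ι κ μ : Type*} (V : μ → Matrix ι κ ℂ) : Matrix (ι × κ) μ ℂ :=
  Matrix.of fun x k => V k x.1 x.2

theorem tensorRep_mul_vectorize_apply {nA nB : ℕ} {μ : Type*}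
    (V : μ → Matrix (Fin (nB + 1)) (Fin (nA + 1)) ℂ) (v : Fin 3 → ℝ)
    (x : Fin (nB + 1) × Fin (nA + 1)) (k : μ) :
    (tensorRep nA nB v * vectorize V) x k = (U nB v * V k * (U nA v)ᴴ) x.1 x.2 := by
  simp only [Matrix.mul_apply, tensorRep, vectorize, Matrix.of_apply, Matrix.kroneckerMap_apply,
    Fintype.sum_prod_type, Matrix.map_apply, Matrix.conjTranspose_apply, RCLike.star_def,
    Finset.sum_mul]
  rw [Finset.sum_comm]
  refine Finset.sum_congr rfl fun i _ => Finset.sum_congr rfl fun j _ => ?_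
  ring

theorem vectorize_mul_apply {ι κ μ ν : Type*} [Fintype μ] (V : μ → Matrix ι κ ℂ) (M : Matrix μ ν ℂ)
    (x : ι × κ) (k : ν) : (vectorize V * M) x k = (∑ j, M j k • V j) x.1 x.2 := by
  simp only [Matrix.mul_apply, vectorize, Matrix.of_apply, Matrix.sum_apply, Matrix.smul_apply,
    smul_eq_mul, mul_comm]

/-- Families of operators transforming like the spin-`n/2` basis are intertwiners. -/
theorem intertwines_vectorize_iff {nA nB n : ℕ}
    {V : Fin (n + 1) → Matrix (Fin (nB + 1)) (Fin (nA + 1)) ℂ} :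
    (∀ k v, U nB v * V k * (U nA v)ᴴ = ∑ k', U n v k' k • V k') ↔
      Intertwines (tensorGen nA nB) (vectorize V) (J n) := by
  rw [← tensorRep_mul_iff]
  constructor
  · intro h v
    ext x k
    rw [tensorRep_mul_vectorize_apply, h, ← U_eq_rotation, vectorize_mul_apply]
  · intro h k v
    ext b a
    have := congrFun (congrFun (h v) (b, a)) k
    rwa [tensorRep_mul_vectorize_apply, ← U_eq_rotation, vectorize_mul_apply] at this

theorem tensorGen_mul_vectorize_apply {nA nB : ℕ} {μ : Type*}
    (V : μ → Matrix (Fin (nB + 1)) (Fin (nA + 1)) ℂ) (a : Fin 3)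
    (x : Fin (nB + 1) × Fin (nA + 1)) (k : μ) :
    (tensorGen nA nB a * vectorize V) x k = (J nB a * V k - V k * J nA a) x.1 x.2 := by
  rw [Matrix.mul_apply, tensorGen, kroneckerSum_apply_sum _ _ x fun y => vectorize V y k]
  simp only [vectorize, Matrix.of_apply, Matrix.sub_apply, Matrix.mul_apply, Matrix.neg_apply,
    Matrix.transpose_apply, neg_mul, Finset.sum_neg_distrib, sub_eq_add_neg]
  simp only [mul_comm]

theorem intertwines_vectorize_iff' {nA nB n : ℕ} {ℬ : Fin 3 → Op n}
    {V : Fin (n + 1) → Matrix (Fin (nB + 1)) (Fin (nA + 1)) ℂ} :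
    Intertwines (tensorGen nA nB) (vectorize V) ℬ ↔
      ∀ a k, J nB a * V k - V k * J nA a = ∑ k', ℬ a k' k • V k' := by
  constructor
  · intro h a k
    ext b c
    have := congrFun (congrFun (h a) (b, c)) k
    rwa [tensorGen_mul_vectorize_apply, vectorize_mul_apply] at this
  · intro h a
    ext x k
    rw [tensorGen_mul_vectorize_apply, h, vectorize_mul_apply]

/-! ### Multiplicity-free decompositions -/

/-- The isometric intertwiners `F i` decompose a representation into pairwise inequivalent irreps
of spin `d i / 2`. -/
structure IsDecomposition {X ι : Type*} [Fintype X] [DecidableEq X] [Fintype ι]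
    (𝒜 : Fin 3 → Matrix X X ℂ) (d : ι → ℕ) (F : (i : ι) → Matrix X (Fin (d i + 1)) ℂ) : Prop where
  hermitian : ∀ a, (𝒜 a)ᴴ = 𝒜 a
  injective : Function.Injective d
  intertwines : ∀ i, Intertwines 𝒜 (F i) (J (d i))
  isometry : ∀ i, (F i)ᴴ * F i = 1
  card : Fintype.card X = ∑ i, (d i + 1)

namespace IsDecomposition

variable {X ι : Type*} [Fintype X] [DecidableEq X] [Fintype ι] {𝒜 : Fin 3 → Matrix X X ℂ}
  {d : ι → ℕ} {F : (i : ι) → Matrix X (Fin (d i + 1)) ℂ}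

theorem conjTranspose_mul_of_ne (h : IsDecomposition 𝒜 d F) {n : ℕ}
    {G : Matrix X (Fin (n + 1)) ℂ} (hG : Intertwines 𝒜 G (J n)) {i : ι} (hi : d i ≠ n) :
    (F i)ᴴ * G = 0 :=
  (((h.intertwines i).conjTranspose h.hermitian (J_isHermitian _)).comp hG).eq_zero hi

/-- Side by side the blocks form an isometry, their ranges being orthogonal by Schur's lemma. The
dimension count makes it square, hence unitary, so no complete reducibility is invoked. -/
theorem sum_mul_conjTranspose (h : IsDecomposition 𝒜 d F) : ∑ i, F i * (F i)ᴴ = 1 := by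
  classical
  let B : Matrix X (Σ i, Fin (d i + 1)) ℂ := Matrix.of fun x s => F s.1 x s.2
  have h1 : Bᴴ * B = 1 := by
    ext ⟨i, k⟩ ⟨j, l⟩
    have e : (Bᴴ * B) ⟨i, k⟩ ⟨j, l⟩ = ((F i)ᴴ * F j) k l := rfl
    rw [e]
    by_cases hij : i = j
    · subst hij
      rw [h.isometry, Matrix.one_apply, Matrix.one_apply]
      simp
    · rw [h.conjTranspose_mul_of_ne (h.intertwines j) fun hd => hij (h.injective hd),
        Matrix.one_apply_ne (fun hs => hij (congrArg Sigma.fst hs)), Matrix.zero_apply]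
  have h2 : B * Bᴴ = 1 := by
    refine (Matrix.mul_eq_one_comm_of_card_eq _ _ _ ?_).mp h1
    rw [h.card]
    simp
  rw [← h2]
  ext x y
  simp only [Matrix.sum_apply, Matrix.mul_apply, Fintype.sum_sigma]
  rfl

theorem eq_sum (h : IsDecomposition 𝒜 d F) {κ : Type*} (G : Matrix X κ ℂ) :
    G = ∑ i, F i * ((F i)ᴴ * G) := by
  conv_lhs => rw [← Matrix.one_mul G, ← h.sum_mul_conjTranspose, Matrix.sum_mul]
  simp only [Matrix.mul_assoc]

theorem eq_zero (h : IsDecomposition 𝒜 d F) {n : ℕ}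
    {G : Matrix X (Fin (n + 1)) ℂ} (hG : Intertwines 𝒜 G (J n)) (hn : ∀ i, d i ≠ n) : G = 0 := by
  rw [h.eq_sum G]
  exact Finset.sum_eq_zero fun i _ => by rw [h.conjTranspose_mul_of_ne hG (hn i), Matrix.mul_zero]

/-- Multiplicity one: in the block expansion of `G` all other spins vanish and the block of spin `d
i / 2` is scalar. -/
theorem exists_eq_smul (h : IsDecomposition 𝒜 d F) {i : ι}
    {G : Matrix X (Fin (d i + 1)) ℂ} (hG : Intertwines 𝒜 G (J (d i))) :
    ∃ c : ℂ, G = c • F i := by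
  refine ⟨((F i)ᴴ * G) (Fin.last _) (Fin.last _), ?_⟩
  conv_lhs => rw [h.eq_sum G]
  rw [Finset.sum_eq_single i]
  · rw [(((h.intertwines i).conjTranspose h.hermitian (J_isHermitian _)).comp hG).eq_smul_one]
    simp
  · intro j _ hj
    rw [h.conjTranspose_mul_of_ne hG fun hd => hj (h.injective hd), Matrix.mul_zero]
  · simp

theorem exists_commutant (h : IsDecomposition 𝒜 d F) {K : Matrix X X ℂ}
    (hK : Intertwines 𝒜 K 𝒜) :
    ∃ c : ι → ℂ, K = ∑ i, c i • (F i * (F i)ᴴ) ∧ ∀ i, K * F i = c i • F i := by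
  choose c hc using fun i => h.exists_eq_smul (hK.comp (h.intertwines i))
  refine ⟨c, ?_, hc⟩
  conv_lhs => rw [← Matrix.mul_one K, ← h.sum_mul_conjTranspose, Matrix.mul_sum]
  refine Finset.sum_congr rfl fun i _ => ?_
  rw [← Matrix.mul_assoc, hc, Matrix.smul_mul]

end IsDecomposition

/-! ### The decomposition of `H_B ⊗ H_A^*` -/

/-- The equivalence of the spin-`n/2` irrep with its dual. -/
noncomputable def dualTwist (n : ℕ) : Op n :=
  Matrix.of fun i j => if i = Fin.rev j then (-1) ^ (j : ℕ) else 0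

theorem mul_dualTwist_apply {n : ℕ} {κ : Type*} (M : Matrix κ (Fin (n + 1)) ℂ) (i : κ)
    (j : Fin (n + 1)) : (M * dualTwist n) i j = M i (Fin.rev j) * (-1) ^ (j : ℕ) := by
  simp [Matrix.mul_apply, dualTwist]

theorem dualTwist_mul_apply {n : ℕ} {κ : Type*} (M : Matrix (Fin (n + 1)) κ ℂ)
    (i : Fin (n + 1)) (j : κ) :
    (dualTwist n * M) i j = (-1) ^ (Fin.rev i : ℕ) * M (Fin.rev i) j := by
  simp only [Matrix.mul_apply, dualTwist, Matrix.of_apply]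
  rw [Finset.sum_eq_single (Fin.rev i)]
  · simp
  · intro k _ hk
    rw [if_neg, zero_mul]
    rintro rfl
    simp at hk
  · simp

theorem dualTwist_mul_conjTranspose (n : ℕ) : dualTwist n * (dualTwist n)ᴴ = 1 := by
  ext i j
  rw [dualTwist_mul_apply, Matrix.conjTranspose_apply, dualTwist, Matrix.of_apply,
    Fin.rev_rev, Matrix.one_apply]
  by_cases h : i = j
  · subst h
    simp [← pow_add, ← two_mul]
  · simp [h, Ne.symm h]

theorem Jminus_mul_dualTwist (n : ℕ) : Jminus n * dualTwist n = -(dualTwist n * Jplus n) := by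
  ext i j
  rw [mul_dualTwist_apply, Matrix.neg_apply, dualTwist_mul_apply]
  simp only [Jminus, Jplus, Matrix.map_apply, lowering_apply, raising_apply, Fin.val_rev]
  by_cases h : n + 1 - ((j : ℕ) + 1) = i + 1
  · rw [if_pos h, if_pos (by omega)]
    have h1 : n + 1 - ((i : ℕ) + 1) = j + 1 := by omega
    have h2 : ((i : ℕ) : ℝ) = n - j - 1 := by
      have : (i : ℕ) + j + 1 = n := by omega
      have h3 : ((i : ℕ) : ℝ) + j + 1 = n := by exact_mod_cast this
      linarith
    rw [h1, pow_succ, h2]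
    have h3 : ((n : ℝ) - j - 1 + 1) * (n - (n - j - 1)) = (j + 1) * (n - j) := by ring
    rw [h3]
    ring
  · rw [if_neg h, if_neg (by omega)]
    simp

theorem Jplus_mul_dualTwist (n : ℕ) : Jplus n * dualTwist n = -(dualTwist n * Jminus n) := by
  ext i j
  rw [mul_dualTwist_apply, Matrix.neg_apply, dualTwist_mul_apply]
  simp only [Jminus, Jplus, Matrix.map_apply, lowering_apply, raising_apply, Fin.val_rev]
  by_cases h : (i : ℕ) = n + 1 - ((j : ℕ) + 1) + 1
  · rw [if_pos h, if_pos (by omega)]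
    have h1 : (j : ℕ) = n + 1 - ((i : ℕ) + 1) + 1 := by omega
    have h2 : ((n + 1 - ((j : ℕ) + 1) : ℕ) : ℝ) = n - j := by
      rw [Nat.cast_sub (by omega)]
      push_cast
      ring
    have h4 : ((n + 1 - ((i : ℕ) + 1) : ℕ) : ℝ) = j - 1 := by
      rw [eq_sub_iff_add_eq]
      exact_mod_cast h1.symm
    rw [h2, h4]
    have h3 : ((n : ℝ) - j + 1) * (n - (n - j)) = (j - 1 + 1) * (n - (j - 1)) := by ring
    rw [h3]
    have h5 : (-1 : ℂ) ^ (j : ℕ) = (-1) ^ (n + 1 - ((i : ℕ) + 1)) * (-1) := by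
      rw [← pow_succ, ← h1]
    rw [h5]
    ring
  · rw [if_neg h, if_neg (by omega)]
    simp

theorem transpose_Jplus (n : ℕ) : (Jplus n)ᵀ = Jminus n := rfl

theorem transpose_Jminus (n : ℕ) : (Jminus n)ᵀ = Jplus n := rfl

theorem dualTwist_intertwines (n : ℕ) :
    Intertwines (fun a => -(J n a)ᵀ) (dualTwist n) (J n) := by
  rw [intertwines_iff_ladder, J_plus, J_minus]
  refine ⟨?_, ?_, ?_⟩
  · rw [smul_neg, ← neg_add, ← Matrix.transpose_smul, ← Matrix.transpose_add, J_plus,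
      transpose_Jplus, Matrix.neg_mul, Jminus_mul_dualTwist, neg_neg]
  · rw [smul_neg, sub_neg_eq_add, neg_add_eq_sub, ← neg_sub, ← Matrix.transpose_smul,
      ← Matrix.transpose_sub, J_minus,
      transpose_Jminus, Matrix.neg_mul, Jplus_mul_dualTwist, neg_neg]
  · ext i j
    rw [mul_dualTwist_apply, J_two, Matrix.diagonal_transpose, Matrix.mul_diagonal,
      Matrix.neg_apply, Matrix.diagonal_apply, dualTwist, Matrix.of_apply]
    by_cases h : i = Fin.rev j
    · subst h
      rw [if_pos rfl, if_pos rfl, mag_eq, mag_eq, Fin.val_rev, Nat.cast_sub (by omega)]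
      push_cast
      ring
    · simp [h]

/-! ### Clebsch–Gordan Kraus operators and the embeddings of the irreps. -/

section Kraus

variable (nA nB n : ℕ)

/-- The Kraus operators of the extremal channel of spin `n/2`. -/
noncomputable def kraus (k : Fin (n + 1)) : Matrix (Fin (nB + 1)) (Fin (nA + 1)) ℂ :=
  Matrix.of fun b a => coupling nB n nA (b, k) a

variable {nA nB n}

/-- The coupling relation for `H_A → H_B ⊗ H_L`, with the action on the index `k` of `H_L` moved to
the other side. This turns it into the dual action. -/
theorem kraus_intertwines (h₁ : nB ≤ n + nA) (h₂ : n ≤ nB + nA) :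
    Intertwines (tensorGen nA nB) (vectorize (kraus nA nB n)) (fun a => -(J n a)ᵀ) := by
  rw [intertwines_vectorize_iff']
  intro a k
  ext b c
  have h := congrFun (congrFun (coupling_intertwines h₁ h₂ a) (b, k)) c
  rw [Matrix.mul_apply, kroneckerSum_apply_sum _ _ (b, k) fun y => coupling nB n nA y c,
    Matrix.mul_apply] at h
  simp only [Matrix.sub_apply, Matrix.mul_apply, kraus, Matrix.of_apply, Matrix.sum_apply,
    Matrix.smul_apply, Matrix.neg_apply, Matrix.transpose_apply, smul_eq_mul, neg_mul,
    Finset.sum_neg_distrib]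
  linear_combination h

/-- The stacked Kraus operators are the Stinespring isometry formed by the coupled states. -/
theorem sum_kraus (h₁ : nB ≤ n + nA) (h₂ : n ≤ nB + nA) (h₃ : nA ≤ nB + n)
    (hp : Even (nB + n + nA)) : ∑ k, (kraus nA nB n k)ᴴ * kraus nA nB n k = 1 := by
  rw [← coupling_orthonormal h₁ h₂ h₃ hp]
  ext a c
  simp only [Matrix.sum_apply, Matrix.mul_apply, Fintype.sum_prod_type]
  rw [Finset.sum_comm]
  rfl

variable (nA nB n) in
/-- The isometric intertwiner of the spin-`n/2` irrep into `H_B ⊗ H_A^*`. -/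
noncomputable def irrepEmbedding : Matrix (Fin (nB + 1) × Fin (nA + 1)) (Fin (n + 1)) ℂ :=
  ((Real.sqrt (((n : ℝ) + 1) / (nA + 1)) : ℝ) : ℂ) • (vectorize (kraus nA nB n) * dualTwist n)

theorem irrepEmbedding_intertwines (h₁ : nB ≤ n + nA) (h₂ : n ≤ nB + nA) :
    Intertwines (tensorGen nA nB) (irrepEmbedding nA nB n) (J n) :=
  ((kraus_intertwines h₁ h₂).comp (dualTwist_intertwines n)).smul _

variable (nA nB n) in
-- The twist identifying the irrep with its dual is unitary and drops out.
theorem irrepEmbedding_mul_conjTranspose :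
    irrepEmbedding nA nB n * (irrepEmbedding nA nB n)ᴴ =
      (((n : ℂ) + 1) / (nA + 1)) • (vectorize (kraus nA nB n) * (vectorize (kraus nA nB n))ᴴ) := by
  rw [irrepEmbedding, Matrix.conjTranspose_smul, Matrix.smul_mul, Matrix.mul_smul, smul_smul,
    Matrix.conjTranspose_mul, Matrix.mul_assoc, ← Matrix.mul_assoc (dualTwist n),
    dualTwist_mul_conjTranspose, Matrix.one_mul, RCLike.star_def, Complex.conj_ofReal,
    ← Complex.ofReal_mul, Real.mul_self_sqrt (by positivity)]
  push_cast
  rfl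

theorem trace_vectorize_kraus (h₁ : nB ≤ n + nA) (h₂ : n ≤ nB + nA) (h₃ : nA ≤ nB + n)
    (hp : Even (nB + n + nA)) :
    (vectorize (kraus nA nB n) * (vectorize (kraus nA nB n))ᴴ).trace = nA + 1 := by
  have h := congrArg Matrix.trace (sum_kraus h₁ h₂ h₃ hp)
  rw [Matrix.trace_one, Fintype.card_fin] at h
  push_cast at h
  rw [← h, Matrix.trace_mul_comm, Matrix.trace_sum]
  simp only [Matrix.trace, Matrix.diag_apply, Matrix.mul_apply, Fintype.sum_prod_type]
  refine Finset.sum_congr rfl fun k _ => ?_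
  rw [Finset.sum_comm]
  rfl

theorem irrepEmbedding_isometry (h₁ : nB ≤ n + nA) (h₂ : n ≤ nB + nA) (h₃ : nA ≤ nB + n)
    (hp : Even (nB + n + nA)) : (irrepEmbedding nA nB n)ᴴ * irrepEmbedding nA nB n = 1 := by
  have hi := irrepEmbedding_intertwines h₁ h₂
  have hs := ((hi.conjTranspose (tensorGen_isHermitian nA nB) (J_isHermitian n)).comp
    hi).eq_smul_one
  -- Schur's lemma has left one scalar, which the trace determines. The factor `√((n+1)/(nA+1))` was
  -- chosen to make it `1`.
  have ht := congrArg Matrix.trace hs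
  rw [Matrix.trace_mul_comm, irrepEmbedding_mul_conjTranspose, Matrix.trace_smul,
    trace_vectorize_kraus h₁ h₂ h₃ hp, Matrix.trace_smul, Matrix.trace_one, Fintype.card_fin,
    smul_eq_mul, smul_eq_mul, div_mul_cancel₀ _ (by exact_mod_cast Nat.succ_ne_zero nA)] at ht
  push_cast at ht
  have hn : (n : ℂ) + 1 ≠ 0 := by exact_mod_cast Nat.succ_ne_zero n
  rw [hs, ← mul_right_cancel₀ hn ((one_mul _).trans ht), one_smul]

end Kraus

/-! ### Admissible spins, isotypic projectors and the Kraus form of `E^L`. -/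

section Admissible

variable {nA nB : ℕ}

theorem twoL_admissible (t : Fin (min nA nB + 1)) :
    nB ≤ twoL nA nB t + nA ∧ twoL nA nB t ≤ nB + nA ∧ nA ≤ nB + twoL nA nB t ∧
      Even (nB + twoL nA nB t + nA) := by
  have ht : (t : ℕ) ≤ min nA nB := Nat.lt_succ_iff.mp t.2
  simp only [twoL]
  refine ⟨by omega, by omega, by omega, ⟨max nA nB + t, by omega⟩⟩

/-- The dimension count: `c = |nA - nB|` gives `∑(2L+1) = d_A d_B`, and `c = 0` gives `∑(2l+1) =
(n+1)²`. -/
theorem sum_range_succ_affine (c m : ℕ) :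
    ∑ t : Fin (m + 1), (c + 2 * (t : ℕ) + 1) = (m + 1) * (c + m + 1) := by
  rw [Fin.sum_univ_eq_sum_range (fun t => c + 2 * t + 1)]
  induction m with
  | zero => simp
  | succ m ih =>
    rw [Finset.sum_range_succ, ih]
    ring

variable (nA nB) in
theorem isDecomposition_irrepEmbedding :
    IsDecomposition (tensorGen nA nB) (twoL nA nB) (fun t => irrepEmbedding nA nB (twoL nA nB t)) where
  hermitian := tensorGen_isHermitian nA nB
  injective := fun t s h => by
    simp only [twoL] at h
    exact Fin.ext (by omega)
  intertwines := fun t => irrepEmbedding_intertwines (twoL_admissible t).1 (twoL_admissible t).2.1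
  isometry := fun t => irrepEmbedding_isometry (twoL_admissible t).1 (twoL_admissible t).2.1
    (twoL_admissible t).2.2.1 (twoL_admissible t).2.2.2
  card := by
    simp only [twoL, sum_range_succ_affine, Fintype.card_prod, Fintype.card_fin]
    rcases le_total nA nB with h | h
    · rw [min_eq_left h, max_eq_right h, Nat.sub_add_cancel h, mul_comm]
    · rw [min_eq_right h, max_eq_left h, Nat.sub_add_cancel h]

/-- By multiplicity one every intertwiner is a multiple of the embedding, so the supremum collapses
to a single range. -/
theorem irrepSubspace_twoL (t : Fin (min nA nB + 1)) : irrepSubspace nA nB (twoL nA nB t) =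
    LinearMap.range (Matrix.toEuclideanLin (irrepEmbedding nA nB (twoL nA nB t))) := by
  have hd := isDecomposition_irrepEmbedding nA nB
  apply le_antisymm
  · refine iSup_le fun ⟨φ, hφ⟩ => ?_
    obtain ⟨G, rfl⟩ := Matrix.toEuclideanLin.surjective φ
    have hG : Intertwines (tensorGen nA nB) G (J (twoL nA nB t)) := by
      rw [← tensorRep_mul_iff]
      intro v
      have := hφ v
      rw [← Matrix.toLpLin_mul, ← Matrix.toLpLin_mul] at this
      exact (Matrix.toEuclideanLin.injective this).symm
    obtain ⟨c, rfl⟩ := hd.exists_eq_smul hG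
    rintro _ ⟨x, rfl⟩
    exact ⟨c • x, by simp⟩
  · refine le_iSup_of_le ⟨Matrix.toEuclideanLin (irrepEmbedding nA nB (twoL nA nB t)), ?_⟩ le_rfl
    intro v
    rw [← Matrix.toLpLin_mul, ← Matrix.toLpLin_mul]
    exact congrArg _ (tensorRep_mul_iff.mpr (hd.intertwines t) v).symm

theorem finrank_irrepSubspace (t : Fin (min nA nB + 1)) :
    Module.finrank ℂ (irrepSubspace nA nB (twoL nA nB t)) = twoL nA nB t + 1 := by
  rw [irrepSubspace_twoL, LinearMap.finrank_range_of_inj]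
  · simp
  · have hd := (isDecomposition_irrepEmbedding nA nB).isometry t
    refine Function.LeftInverse.injective
      (g := Matrix.toEuclideanLin (irrepEmbedding nA nB (twoL nA nB t))ᴴ) fun x => ?_
    rw [← LinearMap.comp_apply, ← Matrix.toLpLin_mul, hd, Matrix.toLpLin_one, LinearMap.id_apply]

/-- For an isometry `F`, the residual `x - FFᴴx` is killed by `Fᴴ`, hence orthogonal to the range of
`F`. -/
theorem irrepProjector_twoL (t : Fin (min nA nB + 1)) : irrepProjector nA nB (twoL nA nB t) =
    irrepEmbedding nA nB (twoL nA nB t) * (irrepEmbedding nA nB (twoL nA nB t))ᴴ := by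
  have hd := (isDecomposition_irrepEmbedding nA nB).isometry t
  rw [irrepProjector, LinearEquiv.symm_apply_eq]
  ext1 x
  change (irrepSubspace nA nB (twoL nA nB t)).starProjection x = _
  apply Submodule.eq_starProjection_of_mem_orthogonal
  · rw [irrepSubspace_twoL, Matrix.toLpLin_mul (q := 2)]
    exact ⟨_, rfl⟩
  · rw [irrepSubspace_twoL, Submodule.mem_orthogonal]
    rintro _ ⟨y, rfl⟩
    rw [← LinearMap.adjoint_inner_right, ← Matrix.toEuclideanLin_conjTranspose_eq_adjoint, map_sub,
      ← LinearMap.comp_apply, ← Matrix.toLpLin_mul, ← Matrix.mul_assoc, hd, Matrix.one_mul,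
      sub_self, inner_zero_right]

theorem extremal_eq (t : Fin (min nA nB + 1)) : extremal nA nB t =
    ofJamiolkowski nA nB ((1 / ((nA : ℂ) + 1)) •
      (vectorize (kraus nA nB (twoL nA nB t)) * (vectorize (kraus nA nB (twoL nA nB t)))ᴴ)) := by
  rw [extremal, irrepProjector_twoL, irrepEmbedding_mul_conjTranspose, smul_smul]
  congr 2
  have h1 : (twoL nA nB t : ℂ) + 1 ≠ 0 := Nat.cast_add_one_ne_zero _
  field_simp

/-- The Kraus decomposition of the extremal channels. -/
theorem extremal_apply (t : Fin (min nA nB + 1)) (X : Op nA) : extremal nA nB t X =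
    ∑ k, kraus nA nB (twoL nA nB t) k * X * (kraus nA nB (twoL nA nB t) k)ᴴ := by
  have h1 : (nA : ℂ) + 1 ≠ 0 := Nat.cast_add_one_ne_zero _
  rw [extremal_eq]
  ext b b'
  simp only [ofJamiolkowski, LinearMap.coe_mk, AddHom.coe_mk, Matrix.of_apply, Matrix.smul_apply,
    Matrix.sum_apply, Matrix.mul_apply, Matrix.conjTranspose_apply, vectorize, smul_eq_mul,
    Finset.sum_mul, Finset.mul_sum]
  rw [Finset.sum_comm_cycle]
  refine Finset.sum_congr rfl fun k _ => ?_
  rw [Finset.sum_comm]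
  refine Finset.sum_congr rfl fun a _ => Finset.sum_congr rfl fun a' _ => ?_
  field_simp

end Admissible

/-! ### Channels and Jamiołkowski operators -/

section Channels

variable {nA nB : ℕ}

theorem amplify_eq_sum {κ : Type*} [Fintype κ] {E : Op nA →ₗ[ℂ] Op nB}
    {V : κ → Matrix (Fin (nB + 1)) (Fin (nA + 1)) ℂ} (hE : ∀ X, E X = ∑ k, V k * X * (V k)ᴴ)
    (d : ℕ) (M : Matrix (Fin d × Fin (nA + 1)) (Fin d × Fin (nA + 1)) ℂ) :
    amplify E d M = ∑ k, ((1 : Matrix (Fin d) (Fin d) ℂ) ⊗ₖ V k) * M *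
      ((1 : Matrix (Fin d) (Fin d) ℂ) ⊗ₖ V k)ᴴ := by
  ext ⟨i, b⟩ ⟨j, b'⟩
  simp [amplify, hE, Matrix.sum_apply, Matrix.mul_apply, Fintype.sum_prod_type, Matrix.one_apply,
    apply_ite (starRingEnd ℂ)]

theorem isChannel_of_kraus {κ : Type*} [Fintype κ] {E : Op nA →ₗ[ℂ] Op nB}
    {V : κ → Matrix (Fin (nB + 1)) (Fin (nA + 1)) ℂ} (hE : ∀ X, E X = ∑ k, V k * X * (V k)ᴴ)
    (hV : ∑ k, (V k)ᴴ * V k = 1) : IsChannel E where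
  completely_positive := fun d M hM => by
    rw [amplify_eq_sum hE]
    exact Matrix.posSemidef_sum _ fun k _ => hM.mul_mul_conjTranspose_same _
  trace_preserving := fun X => by
    rw [hE, Matrix.trace_sum]
    conv_rhs => rw [← Matrix.one_mul X, ← hV, Matrix.sum_mul, Matrix.trace_sum]
    refine Finset.sum_congr rfl fun k _ => ?_
    rw [Matrix.trace_mul_comm, Matrix.mul_assoc]

theorem jamiolkowski_ofJamiolkowski
    (K : Matrix (Fin (nB + 1) × Fin (nA + 1)) (Fin (nB + 1) × Fin (nA + 1)) ℂ) :
    jamiolkowski (ofJamiolkowski nA nB K) = K := by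
  have h1 : (nA : ℂ) + 1 ≠ 0 := Nat.cast_add_one_ne_zero _
  ext ⟨b, a⟩ ⟨b', a'⟩
  simp [jamiolkowski, ofJamiolkowski, Matrix.single_apply, ite_and, h1]

theorem jamiolkowski_injective {E E' : Op nA →ₗ[ℂ] Op nB} (h : jamiolkowski E = jamiolkowski E') :
    E = E' := by
  have h1 : (1 : ℂ) / ((nA : ℂ) + 1) ≠ 0 := one_div_ne_zero (Nat.cast_add_one_ne_zero _)
  refine Matrix.ext_linearMap ℂ fun a a' => ?_
  ext b b'
  exact mul_left_cancel₀ h1 (congrFun (congrFun h (b, a)) (b', a'))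

theorem jamiolkowski_sum_smul {ι : Type*} [Fintype ι] (c : ι → ℂ) (E : ι → Op nA →ₗ[ℂ] Op nB) :
    jamiolkowski (∑ i, c i • E i) = ∑ i, c i • jamiolkowski (E i) := by
  ext x y
  simp only [jamiolkowski, Matrix.of_apply, LinearMap.sum_apply, LinearMap.smul_apply,
    Matrix.sum_apply, Matrix.smul_apply, smul_eq_mul, Finset.mul_sum]
  exact Finset.sum_congr rfl fun i _ => by ring

theorem tensorRep_mul_jamiolkowski_apply (E : Op nA →ₗ[ℂ] Op nB) (v : Fin 3 → ℝ)
    (b b' : Fin (nB + 1)) (a a' : Fin (nA + 1)) :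
    (tensorRep nA nB v * jamiolkowski E) (b, a) (b', a') =
      (1 / ((nA : ℂ) + 1)) * (U nB v * E ((U nA v)ᴴ * Matrix.single a a' 1)) b b' := by
  have h : (U nA v)ᴴ * Matrix.single a a' 1 =
      ∑ c, (starRingEnd ℂ) (U nA v a c) • Matrix.single c a' (1 : ℂ) := by
    ext i j
    by_cases hj : a' = j
    · subst hj
      simp [Matrix.sum_apply, Matrix.single_apply]
    · simp [Matrix.sum_apply, hj,
        Matrix.mul_single_apply_of_ne _ _ _ _ _ (Ne.symm hj)]
  rw [h, map_sum]
  simp only [Matrix.mul_apply, tensorRep, jamiolkowski, Matrix.of_apply, Matrix.kroneckerMap_apply,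
    Fintype.sum_prod_type, Matrix.map_apply, map_smul, Matrix.sum_apply, Matrix.smul_apply,
    smul_eq_mul, Finset.mul_sum]
  exact Finset.sum_congr rfl fun i _ => Finset.sum_congr rfl fun j _ => by ring

theorem jamiolkowski_mul_tensorRep_apply (E : Op nA →ₗ[ℂ] Op nB) (v : Fin 3 → ℝ)
    (b b' : Fin (nB + 1)) (a a' : Fin (nA + 1)) :
    (jamiolkowski E * tensorRep nA nB v) (b, a) (b', a') =
      (1 / ((nA : ℂ) + 1)) * (E (Matrix.single a a' 1 * (U nA v)ᴴ) * U nB v) b b' := by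
  have h : Matrix.single a a' 1 * (U nA v)ᴴ =
      ∑ c, (starRingEnd ℂ) (U nA v c a') • Matrix.single a c (1 : ℂ) := by
    ext i j
    by_cases hi : a = i
    · subst hi
      simp [Matrix.sum_apply, Matrix.single_apply]
    · simp [Matrix.sum_apply, hi,
        Matrix.single_mul_apply_of_ne _ _ _ _ _ (Ne.symm hi)]
  rw [h, map_sum]
  simp only [Matrix.mul_apply, tensorRep, jamiolkowski, Matrix.of_apply, Matrix.kroneckerMap_apply,
    Fintype.sum_prod_type, Matrix.map_apply, map_smul, Matrix.sum_apply, Matrix.smul_apply,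
    smul_eq_mul, Finset.mul_sum, Finset.sum_mul]
  exact Finset.sum_congr rfl fun i _ => Finset.sum_congr rfl fun j _ => by ring

/-- Covariance of a map as invariance of its Jamiołkowski operator. -/
theorem covariant_iff {E : Op nA →ₗ[ℂ] Op nB} :
    (∀ (v : Fin 3 → ℝ) (X : Op nA),
      (U nB v)ᴴ * E (U nA v * X * (U nA v)ᴴ) * U nB v = E X) ↔
    Intertwines (tensorGen nA nB) (jamiolkowski E) (tensorGen nA nB) := by
  have h1 : (1 : ℂ) / ((nA : ℂ) + 1) ≠ 0 := one_div_ne_zero (Nat.cast_add_one_ne_zero _)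
  rw [← tensorRep_mul_iff, ← tensorRep_eq_rotation]
  refine forall_congr' fun v => ⟨fun h => ?_, fun h X => ?_⟩
  · ext ⟨b, a⟩ ⟨b', a'⟩
    rw [tensorRep_mul_jamiolkowski_apply, jamiolkowski_mul_tensorRep_apply]
    -- Covariance is used at `X = U_A† e_{aa'}`, so that the left rotation cancels.
    rw [← h ((U nA v)ᴴ * Matrix.single a a' 1), ← Matrix.mul_assoc, ← Matrix.mul_assoc,
      ← Matrix.mul_assoc, U_mul_conjTranspose, U_mul_conjTranspose, Matrix.one_mul, Matrix.one_mul]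
  -- Commutation says `U_B E(U_A† Y) = E(Y U_A†) U_B` for matrix units `Y`, hence for all `Y`.
  -- Covariance is the case `Y = U_A X`.
  · have e : LinearMap.mulLeft ℂ (U nB v) ∘ₗ E ∘ₗ LinearMap.mulLeft ℂ (U nA v)ᴴ =
        LinearMap.mulRight ℂ (U nB v) ∘ₗ E ∘ₗ LinearMap.mulRight ℂ (U nA v)ᴴ := by
      refine Matrix.ext_linearMap ℂ fun a a' => ?_
      ext b b'
      have := congrFun (congrFun h (b, a)) (b', a')
      rw [tensorRep_mul_jamiolkowski_apply, jamiolkowski_mul_tensorRep_apply] at this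
      exact mul_left_cancel₀ h1 this
    have e2 := LinearMap.congr_fun e (U nA v * X)
    simp only [LinearMap.comp_apply, LinearMap.mulLeft_apply, LinearMap.mulRight_apply] at e2
    rw [← Matrix.mul_assoc, conjTranspose_mul_U, Matrix.one_mul] at e2
    rw [Matrix.mul_assoc, ← e2, ← Matrix.mul_assoc, conjTranspose_mul_U, Matrix.one_mul]

/-- Complete positivity is applied with an ancilla of dimension `d_A` to the unnormalised maximally
entangled state. The two tensor factors then have to be swapped. -/
theorem jamiolkowski_posSemidef {E : Op nA →ₗ[ℂ] Op nB} (hE : IsChannel E) :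
    (jamiolkowski E).PosSemidef := by
  let w : Fin (nA + 1) × Fin (nA + 1) → ℂ := fun x => if x.1 = x.2 then 1 else 0
  have h := (hE.completely_positive (nA + 1) _ (Matrix.posSemidef_vecMulVec_self_star w)).submatrix
    (Prod.swap : Fin (nB + 1) × Fin (nA + 1) → _)
  have hc : (0 : ℂ) ≤ 1 / ((nA : ℂ) + 1) := by
    have h0 : (0 : ℝ) ≤ 1 / ((nA : ℝ) + 1) := by positivity
    have h1 := Complex.zero_le_real.mpr h0
    push_cast at h1
    exact h1
  have e : jamiolkowski E = (1 / ((nA : ℂ) + 1)) •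
      (amplify E (nA + 1) (Matrix.vecMulVec w (star w))).submatrix Prod.swap Prod.swap := by
    ext ⟨b, a⟩ ⟨b', a'⟩
    have h2 : (Matrix.of fun c c' => Matrix.vecMulVec w (star w) (a, c) (a', c')) =
        Matrix.single a a' (1 : ℂ) := by
      ext c c'
      by_cases h1 : a = c <;> by_cases h3 : a' = c' <;>
        simp [Matrix.vecMulVec_apply, w, h1, h3]
    simp only [jamiolkowski, amplify, Matrix.of_apply, Matrix.smul_apply, Matrix.submatrix_apply,
      Prod.swap, h2, smul_eq_mul]
  rw [e]
  exact h.smul hc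

theorem amplify_sum_smul {ι : Type*} [Fintype ι] (c : ι → ℂ) (E : ι → Op nA →ₗ[ℂ] Op nB) (d : ℕ)
    (M : Matrix (Fin d × Fin (nA + 1)) (Fin d × Fin (nA + 1)) ℂ) :
    amplify (∑ i, c i • E i) d M = ∑ i, c i • amplify (E i) d M := by
  ext x y
  simp [amplify, LinearMap.sum_apply, Matrix.sum_apply]

theorem IsCovariantChannel.convexCombination {ι : Type*} [Fintype ι] {p : ι → ℝ}
    (hp : p ∈ stdSimplex ℝ ι) {E : ι → Op nA →ₗ[ℂ] Op nB} (hE : ∀ i, IsCovariantChannel (E i)) :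
    IsCovariantChannel (∑ i, (p i : ℂ) • E i) where
  isChannel :=
    { completely_positive := fun d M hM => by
        rw [amplify_sum_smul]
        exact Matrix.posSemidef_sum _ fun i _ =>
          ((hE i).isChannel.completely_positive d M hM).smul (by exact_mod_cast hp.1 i)
      trace_preserving := fun X => by
        have : ∑ i, (p i : ℂ) = 1 := by exact_mod_cast hp.2
        simp only [LinearMap.sum_apply, LinearMap.smul_apply, Matrix.trace_sum, Matrix.trace_smul,
          (hE _).isChannel.trace_preserving, ← Finset.sum_smul, this, one_smul] }
  covariant := by
    rw [covariant_iff, jamiolkowski_sum_smul]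
    intro a
    rw [Matrix.mul_sum, Matrix.sum_mul]
    exact Finset.sum_congr rfl fun i _ => ((covariant_iff.mp (hE i).covariant).smul _) a

variable (nA nB) in
theorem jamiolkowski_extremal (t : Fin (min nA nB + 1)) : jamiolkowski (extremal nA nB t) =
    (1 / ((twoL nA nB t : ℂ) + 1)) • irrepProjector nA nB (twoL nA nB t) :=
  jamiolkowski_ofJamiolkowski _

theorem extremal_isCovariantChannel (t : Fin (min nA nB + 1)) :
    IsCovariantChannel (extremal nA nB t) where
  isChannel := isChannel_of_kraus (extremal_apply t) (sum_kraus (twoL_admissible t).1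
    (twoL_admissible t).2.1 (twoL_admissible t).2.2.1 (twoL_admissible t).2.2.2)
  covariant := by
    have hd := isDecomposition_irrepEmbedding nA nB
    rw [covariant_iff, jamiolkowski_extremal, irrepProjector_twoL]
    exact ((hd.intertwines t).comp
      ((hd.intertwines t).conjTranspose hd.hermitian (J_isHermitian _))).smul _

/-- Each weight is visible as an eigenvalue on its block, which gives uniqueness of the mixture. -/
theorem jamiolkowski_mul_irrepEmbedding (p : Fin (min nA nB + 1) → ℂ) (s : Fin (min nA nB + 1)) :
    jamiolkowski (∑ t, p t • extremal nA nB t) * irrepEmbedding nA nB (twoL nA nB s) =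
      (p s / ((twoL nA nB s : ℂ) + 1)) • irrepEmbedding nA nB (twoL nA nB s) := by
  have hd := isDecomposition_irrepEmbedding nA nB
  rw [jamiolkowski_sum_smul, Matrix.sum_mul, Finset.sum_eq_single s]
  · rw [jamiolkowski_extremal, irrepProjector_twoL, smul_smul, Matrix.smul_mul, Matrix.mul_assoc,
      hd.isometry s, Matrix.mul_one, mul_one_div]
  · intro t _ ht
    rw [jamiolkowski_extremal, irrepProjector_twoL, smul_smul, Matrix.smul_mul, Matrix.mul_assoc,
      hd.conjTranspose_mul_of_ne (hd.intertwines s) fun h => ht (hd.injective h), Matrix.mul_zero,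
      smul_zero]
  · simp

theorem irrepEmbedding_ne_zero (t : Fin (min nA nB + 1)) :
    irrepEmbedding nA nB (twoL nA nB t) ≠ 0 := by
  intro h
  have := (isDecomposition_irrepEmbedding nA nB).isometry t
  simp only [h, Matrix.mul_zero] at this
  exact zero_ne_one this

/-- Covariant channels are exactly the unique mixtures of the extremal ones. -/
theorem IsCovariantChannel.existsUnique {E : Op nA →ₗ[ℂ] Op nB} (hE : IsCovariantChannel E) :
    ∃! p : Fin (min nA nB + 1) → ℝ,
      p ∈ stdSimplex ℝ (Fin (min nA nB + 1)) ∧ E = ∑ t, (p t : ℂ) • extremal nA nB t := by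
  have hd := isDecomposition_irrepEmbedding nA nB
  obtain ⟨c, hc, hcF⟩ := hd.exists_commutant (covariant_iff.mp hE.covariant)
  have hn : ∀ t : Fin (min nA nB + 1), (twoL nA nB t : ℂ) + 1 ≠ 0 :=
    fun t => Nat.cast_add_one_ne_zero _
  -- Compressing the positive Jamiołkowski operator to block `t` leaves `c t` times the identity.
  have hpos : ∀ t, 0 ≤ c t := by
    intro t
    have h := (jamiolkowski_posSemidef hE.isChannel).conjTranspose_mul_mul_same
      (irrepEmbedding nA nB (twoL nA nB t))
    rw [Matrix.mul_assoc, hcF, Matrix.mul_smul, hd.isometry] at h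
    simpa using h.diag_nonneg (i := 0)
  have hre : ∀ t, c t = ((c t).re : ℂ) := fun t => (Complex.eq_re_of_ofReal_le (r := 0)
    (by simpa using hpos t))
  -- The factor `2L+1` compensates the normalisation `I^L / (2L+1)`.
  have hE' : E = ∑ t, (((c t).re * (twoL nA nB t + 1) : ℝ) : ℂ) • extremal nA nB t := by
    apply jamiolkowski_injective
    rw [jamiolkowski_sum_smul, hc]
    refine Finset.sum_congr rfl fun t _ => ?_
    rw [jamiolkowski_extremal, irrepProjector_twoL, smul_smul]
    congr 1
    push_cast
    rw [← hre t]
    field_simp [hn t]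
  refine ⟨_, ⟨⟨fun t => ?_, ?_⟩, hE'⟩, fun q hq => ?_⟩
  · have := (Complex.le_def.mp (hpos t)).1
    exact mul_nonneg (by simpa using this) (by positivity)
  -- Tracing the image of the identity gives `d_A = (∑ p) d_A`.
  · have h2 : ((1 : Op nA).trace : ℂ) =
        (∑ t, (((c t).re * (twoL nA nB t + 1) : ℝ) : ℂ)) * (1 : Op nA).trace := by
      conv_lhs => rw [← hE.isChannel.trace_preserving, hE']
      simp only [LinearMap.sum_apply, LinearMap.smul_apply, Matrix.trace_sum, Matrix.trace_smul,
        (extremal_isCovariantChannel _).isChannel.trace_preserving, smul_eq_mul,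
        ← Finset.sum_mul]
    rw [Matrix.trace_one, Fintype.card_fin] at h2
    have h3 := mul_right_cancel₀ (Nat.cast_ne_zero.mpr (Nat.succ_ne_zero nA))
      ((one_mul _).trans h2)
    exact_mod_cast h3.symm
  · funext s
    have h1 := jamiolkowski_mul_irrepEmbedding (nA := nA) (nB := nB) (fun t => (q t : ℂ)) s
    rw [← hq.2, hcF] at h1
    have h2 := smul_left_injective ℂ (irrepEmbedding_ne_zero s) h1
    rw [hre s, eq_div_iff (hn s)] at h2
    exact_mod_cast h2.symm

end Channels

/-! ### Irreducible tensor operators -/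

section Tensors

theorem vectorize_conjTranspose_mul_apply {ι κ μ ν : Type*} [Fintype ι] [Fintype κ]
    (V : μ → Matrix ι κ ℂ) (W : ν → Matrix ι κ ℂ) (i : μ) (j : ν) :
    ((vectorize V)ᴴ * vectorize W) i j = ((V i)ᴴ * W j).trace := by
  simp only [Matrix.trace, Matrix.diag_apply, Matrix.mul_apply, Fintype.sum_prod_type,
    Matrix.conjTranspose_apply, vectorize, Matrix.of_apply]
  exact Finset.sum_comm

variable {n : ℕ} {T : (l : ℕ) → Fin (2 * l + 1) → Op n}

theorem IsITOBasis.intertwines (hT : IsITOBasis n T) {l : ℕ} (hl : l ≤ n) :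
    Intertwines (tensorGen n n) (vectorize (T l)) (J (2 * l)) :=
  intertwines_vectorize_iff.mp (hT.transforms l hl)

/-- Hilbert–Schmidt orthonormality within a rank is the isometry property after vectorisation. The
ranks `l ≤ n` fill `H ⊗ H^*` by dimension. -/
theorem IsITOBasis.isDecomposition (hT : IsITOBasis n T) :
    IsDecomposition (tensorGen n n) (fun l : Fin (n + 1) => 2 * (l : ℕ))
      (fun l => vectorize (T l)) where
  hermitian := tensorGen_isHermitian n n
  injective := fun l m h => Fin.ext (by simpa using h)
  intertwines := fun l => hT.intertwines (Nat.lt_succ_iff.mp l.2)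
  isometry := fun l => by
    ext i j
    rw [vectorize_conjTranspose_mul_apply, hT.orthonormal l (by omega) l (by omega),
      Matrix.one_apply]
    simp [Fin.ext_iff, eq_comm]
  card := by
    have := sum_range_succ_affine 0 n
    simp only [zero_add] at this
    simp [this]

theorem IsITOBasis.expansion (hT : IsITOBasis n T) (X : Op n) :
    X = ∑ l ∈ Finset.range (n + 1), ∑ k, ((T l k)ᴴ * X).trace • T l k := by
  have h := hT.isDecomposition.eq_sum (vectorize fun _ : Unit => X)
  rw [← Fin.sum_univ_eq_sum_range (fun l => ∑ k, ((T l k)ᴴ * X).trace • T l k)]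
  ext b a
  have h2 := congrFun (congrFun h (b, a)) ()
  rw [Matrix.sum_apply] at h2 ⊢
  simp only [vectorize_mul_apply, vectorize_conjTranspose_mul_apply] at h2
  exact h2

theorem IsITOBasis.ne_zero (hT : IsITOBasis n T) {l : ℕ} (hl : l ≤ n) (k : Fin (2 * l + 1)) :
    T l k ≠ 0 := by
  intro h
  have := hT.orthonormal l hl l hl k k
  simp [h] at this

/-- An intertwiner of spin `l` is a multiple of the given tensor operator. -/
theorem IsITOBasis.exists_smul (hT : IsITOBasis n T) {l : ℕ} (hl : l ≤ n)
    {V : Fin (2 * l + 1) → Op n} (hV : Intertwines (tensorGen n n) (vectorize V) (J (2 * l))) :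
    ∃ c : ℂ, ∀ k, V k = c • T l k := by
  obtain ⟨c, hc⟩ := hT.isDecomposition.exists_eq_smul (i := ⟨l, by omega⟩) hV
  refine ⟨c, fun k => ?_⟩
  ext b a
  exact congrFun (congrFun hc (b, a)) k

variable {nA nB : ℕ} {T : (l : ℕ) → Fin (2 * l + 1) → Op nA}
  {S : (l : ℕ) → Fin (2 * l + 1) → Op nB} {E : Op nA →ₗ[ℂ] Op nB}

/-- Covariance carries a tensor family to one with the same transformation matrices. By Schur's
lemma its image is then a multiple of the output family, or zero if that rank does not occur. -/
theorem IsCovariantChannel.map_intertwines (hE : IsCovariantChannel E) {n : ℕ}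
    {V : Fin (n + 1) → Op nA} (hV : Intertwines (tensorGen nA nA) (vectorize V) (J n)) :
    Intertwines (tensorGen nB nB) (vectorize fun k => E (V k)) (J n) := by
  rw [← intertwines_vectorize_iff] at hV ⊢
  intro k v
  rw [← hE.covariant v (V k), hV, ← Matrix.mul_assoc, ← Matrix.mul_assoc, U_mul_conjTranspose,
    Matrix.one_mul, Matrix.mul_assoc, U_mul_conjTranspose, Matrix.mul_one, map_sum]
  simp only [map_smul]

theorem IsCovariantChannel.map_tensor (hE : IsCovariantChannel E) (hT : IsITOBasis nA T)
    (hS : IsITOBasis nB S) {l : ℕ} (hA : l ≤ nA) (hB : l ≤ nB) (k : Fin (2 * l + 1)) :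
    E (T l k) = scaling T S E l • S l k := by
  obtain ⟨c, hc⟩ := hS.exists_smul hB (hE.map_intertwines (hT.intertwines hA))
  have : scaling T S E l = c := by
    rw [scaling, hc, Matrix.mul_smul, Matrix.trace_smul, hS.orthonormal l hB l hB]
    simp
  rw [hc, this]

theorem IsCovariantChannel.map_tensor_eq_zero (hE : IsCovariantChannel E) (hT : IsITOBasis nA T)
    (hS : IsITOBasis nB S) {l : ℕ} (hA : l ≤ nA) (hB : nB < l) (k : Fin (2 * l + 1)) :
    E (T l k) = 0 := by
  have h := hS.isDecomposition.eq_zero (hE.map_intertwines (hT.intertwines hA))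
    (fun i => by have := i.2; omega)
  ext b a
  exact congrFun (congrFun h (b, a)) k

theorem IsCovariantChannel.apply_eq (hE : IsCovariantChannel E) (hT : IsITOBasis nA T)
    (hS : IsITOBasis nB S) (X : Op nA) : E X = ∑ l ∈ Finset.range (min nA nB + 1), ∑ k,
      (scaling T S E l * ((T l k)ᴴ * X).trace) • S l k := by
  conv_lhs => rw [hT.expansion X, map_sum]
  simp only [map_sum, map_smul]
  rw [← Finset.sum_subset (Finset.range_subset_range.mpr (Nat.succ_le_succ (min_le_left nA nB)))]
  · refine Finset.sum_congr rfl fun l hl => Finset.sum_congr rfl fun k _ => ?_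
    rw [Finset.mem_range] at hl
    rw [hE.map_tensor hT hS (by omega) (by omega), smul_smul, mul_comm]
  · intro l hl hl'
    rw [Finset.mem_range] at hl hl'
    exact Finset.sum_eq_zero fun k _ => by
      rw [hE.map_tensor_eq_zero hT hS (by omega) (by omega), smul_zero]

theorem scaling_sum_smul {ι : Type*} [Fintype ι] (c : ι → ℂ) (E : ι → Op nA →ₗ[ℂ] Op nB) (l : ℕ) :
    scaling T S (∑ i, c i • E i) l = ∑ i, c i * scaling T S (E i) l := by
  simp only [scaling, LinearMap.sum_apply, LinearMap.smul_apply, Matrix.mul_sum, Matrix.trace_sum,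
    Matrix.mul_smul, Matrix.trace_smul, smul_eq_mul]

end Tensors

/-! ### Reduced matrix elements and the Clebsch–Gordan formula -/

section WignerEckart

/-- `J^x` and `J^z` are symmetric and `J^y` is antisymmetric in the standard basis. -/
theorem transpose_J (n : ℕ) (a : Fin 3) : (J n a)ᵀ = (![1, -1, 1] a : ℂ) • J n a := by
  fin_cases a
  · simp [J_zero, transpose_Jplus, transpose_Jminus, add_comm]
  · simp only [Fin.mk_one, J_one, Matrix.transpose_smul, Matrix.transpose_sub, transpose_Jplus,
      transpose_Jminus, Matrix.cons_val_one, Matrix.cons_val_zero]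
    module
  · simp [J_two]

variable {n l : ℕ}

variable (n l) in
/-- The tensor operator whose matrix elements are the Clebsch–Gordan coefficients. -/
noncomputable def cgTensor (k : Fin (2 * l + 1)) : Op n :=
  Matrix.of fun m' m => coupling n (2 * l) n (m, k) m'

/-- In the coupling relation the generators act on `m`, `k` and `m'` transposed to what a tensor
operator needs. Transposing each of them costs the same sign, which cancels. -/
theorem cgTensor_intertwines (hl : l ≤ n) :
    Intertwines (tensorGen n n) (vectorize (cgTensor n l)) (J (2 * l)) := by
  rw [intertwines_vectorize_iff']
  intro a k
  ext m' m
  have h := congrFun (congrFun (coupling_intertwines (n₁ := n) (n₂ := 2 * l) (n₃ := n)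
    (by omega) (by omega) a) (m, k)) m'
  rw [Matrix.mul_apply, kroneckerSum_apply_sum _ _ (m, k) fun y => coupling n (2 * l) n y m',
    Matrix.mul_apply] at h
  have ht : ∀ (r : ℕ) (i j : Fin (r + 1)), J r a i j = (![1, -1, 1] a : ℂ) * J r a j i := by
    intro r i j
    have := congrFun (congrFun (transpose_J r a) j) i
    rwa [Matrix.transpose_apply, Matrix.smul_apply, smul_eq_mul] at this
  have hs : (![1, -1, 1] a : ℂ) * ![1, -1, 1] a = 1 := by
    fin_cases a <;> simp
  have e1 : ∑ i, J n a m i * coupling n (2 * l) n (i, k) m' =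
      (![1, -1, 1] a : ℂ) * ∑ i, coupling n (2 * l) n (i, k) m' * J n a i m := by
    rw [Finset.mul_sum]
    exact Finset.sum_congr rfl fun i _ => by rw [ht n m i]; ring
  have e2 : ∑ i, J (2 * l) a k i * coupling n (2 * l) n (m, i) m' =
      (![1, -1, 1] a : ℂ) * ∑ i, J (2 * l) a i k * coupling n (2 * l) n (m, i) m' := by
    rw [Finset.mul_sum]
    exact Finset.sum_congr rfl fun i _ => by rw [ht (2 * l) k i]; ring
  have e3 : ∑ i, coupling n (2 * l) n (m, k) i * J n a i m' =
      (![1, -1, 1] a : ℂ) * ∑ i, J n a m' i * coupling n (2 * l) n (m, k) i := by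
    rw [Finset.mul_sum]
    exact Finset.sum_congr rfl fun i _ => by rw [ht n i m']; ring
  simp only at h
  rw [e1, e2, e3] at h
  simp only [Matrix.sub_apply, Matrix.mul_apply, cgTensor, Matrix.of_apply, Matrix.sum_apply,
    Matrix.smul_apply, smul_eq_mul]
  linear_combination -(![1, -1, 1] a : ℂ) * h + (
    - ∑ i, J n a m' i * coupling n (2 * l) n (m, k) i
    + ∑ i, coupling n (2 * l) n (i, k) m' * J n a i m
    + ∑ i, J (2 * l) a i k * coupling n (2 * l) n (m, i) m') * hs

theorem cgTensor_apply (hl : l ≤ n) (k : Fin (2 * l + 1)) (m m' : Fin (n + 1)) :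
    cgTensor n l k m' m = (cg n (twoM n m) (2 * l) (twoM (2 * l) k) n (twoM n m') : ℂ) := by
  rw [cg_eq (by omega) (by omega) (by omega)]
  rfl

/-- The Wigner–Eckart theorem for normalised irreducible tensor operators. -/
theorem IsITOBasis.exists_isReducedElement {T : (l : ℕ) → Fin (2 * l + 1) → Op n}
    (hT : IsITOBasis n T) (hl : l ≤ n) : ∃ r : ℂ, IsReducedElement n l (T l) r := by
  obtain ⟨c, hc⟩ := hT.exists_smul hl (cgTensor_intertwines hl)
  -- If `c` vanished, so would the coupling matrix, contradicting its isometry.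
  have hc0 : c ≠ 0 := by
    rintro rfl
    have h1 : coupling n (2 * l) n = 0 := by
      ext ⟨m, k⟩ m'
      have := congrFun (congrFun (hc k) m') m
      simpa [cgTensor] using this
    have h2 := coupling_orthonormal (n₁ := n) (n₂ := 2 * l) (n₃ := n) (by omega) (by omega)
      (by omega) ⟨n + l, by omega⟩
    rw [h1, Matrix.mul_zero] at h2
    exact zero_ne_one h2
  refine ⟨c⁻¹, fun k m m' => ?_⟩
  rw [← cgTensor_apply hl, hc, Matrix.smul_apply, smul_eq_mul]
  field_simp

theorem twoM_last (n : ℕ) : twoM n (Fin.last n) = n := by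
  simp only [twoM, Fin.val_last]
  ring

theorem twoM_midIdx (l : ℕ) : twoM (2 * l) (midIdx l) = 0 := by
  simp [twoM, midIdx]

/-- This is the `m₁ = j₁` component of the normalised highest-weight vector, whose formula is
explicit. -/
theorem cg_highest_ne_zero (hl : l ≤ n) : cg n n (2 * l) 0 n n ≠ 0 := by
  have h := cg_eq (n₁ := n) (n₂ := 2 * l) (n₃ := n) (by omega) (by omega) (by omega)
    (Fin.last n) (midIdx l) (Fin.last n)
  rw [twoM_last, twoM_midIdx] at h
  rw [h, coupledState_last, Pi.smul_apply, smul_eq_mul]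
  refine mul_ne_zero (one_div_ne_zero (hwNorm_pos (by omega) (by omega) ⟨n + l, by omega⟩).ne')
    (highestWeight_ne_zero _ ?_)
  simp only [midIdx]

/-- The selection rule `m₁ + m₂ = M`, obtained by comparing `J^z`-eigenvalues. -/
theorem coupledState_eq_zero {n₁ n₂ n₃ : ℕ} {a : Fin (n₁ + 1)} {b : Fin (n₂ + 1)}
    {c : Fin (n₃ + 1)} (h : twoM n₁ a + twoM n₂ b ≠ twoM n₃ c) :
    coupledState n₁ n₂ n₃ c (a, b) = 0 := by
  have hw := congrFun (congrFun (totalWeight_mul_coupledMatrix (n₁ := n₁) (n₂ := n₂) (n₃ := n₃))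
    (a, b)) c
  rw [Matrix.mul_apply, totalWeight,
    kroneckerSum_apply_sum _ _ (a, b) fun y => coupledMatrix n₁ n₂ n₃ y c, weight, weight, weight,
    Matrix.mul_diagonal] at hw
  simp only [Matrix.diagonal_apply, ite_mul, zero_mul, Finset.sum_ite_eq, Finset.mem_univ,
    if_true, coupledMatrix, Matrix.of_apply] at hw
  by_contra h0
  have h2 : coupledState n₁ n₂ n₃ c (a, b) * (mag n₁ a + mag n₂ b - mag n₃ c) = 0 := by
    linear_combination hw
  have h3 := (mul_eq_zero.mp h2).resolve_left h0
  simp only [mag] at h3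
  apply h
  have h4 : (twoM n₁ a : ℝ) + twoM n₂ b = twoM n₃ c := by linarith
  exact_mod_cast h4

theorem cg_eq_zero {n₁ n₂ n₃ : ℕ} (μ₁ μ₂ μ₃ : ℤ) (h : ∀ c : Fin (n₃ + 1), twoM n₃ c ≠ μ₃) :
    cg n₁ μ₁ n₂ μ₂ n₃ μ₃ = 0 := by
  simp [cg, h]

variable {nA nB : ℕ}

theorem kraus_last_apply {L : ℕ} (k : Fin (L + 1)) (a : Fin (nA + 1)) :
    kraus nA nB L k (Fin.last nB) a = (coupledState nB L nA a (Fin.last nB, k) : ℂ) := rfl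

/-- The Clebsch–Gordan formula for the scaling factors of the extremal channels. -/
theorem scaling_extremal {T : (l : ℕ) → Fin (2 * l + 1) → Op nA}
    {S : (l : ℕ) → Fin (2 * l + 1) → Op nB} (hT : IsITOBasis nA T) (hS : IsITOBasis nB S)
    (hA : l ≤ nA) (hB : l ≤ nB) {rT rS : ℂ} (hrT : IsReducedElement nA l (T l) rT)
    (hrS : IsReducedElement nB l (S l) rS) (hrS0 : rS ≠ 0) (t : Fin (min nA nB + 1)) :
    scaling T S (extremal nA nB t) l = rT / rS *
      ((∑ k : Fin (twoL nA nB t + 1),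
        cg nA (nB + twoM (twoL nA nB t) k) (2 * l) 0 nA (nB + twoM (twoL nA nB t) k) /
            cg nB nB (2 * l) 0 nB nB *
          cg nB nB (twoL nA nB t) (twoM (twoL nA nB t) k) nA
            (nB + twoM (twoL nA nB t) k) ^ 2 : ℝ) : ℂ) := by
  have hc0 : (cg nB nB (2 * l) 0 nB nB : ℂ) ≠ 0 :=
    Complex.ofReal_ne_zero.mpr (cg_highest_ne_zero hB)
  -- The diagonal entry at `|j_B,j_B⟩` is the one to compare, since there `S^l_0` is known not to
  -- vanish.
  have h := congrFun (congrFun ((extremal_isCovariantChannel t).map_tensor hT hS hA hB (midIdx l))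
    (Fin.last nB)) (Fin.last nB)
  rw [extremal_apply, Matrix.smul_apply, hrS, twoM_last, twoM_midIdx, Matrix.sum_apply,
    smul_eq_mul] at h
  have hterm : ∀ k : Fin (twoL nA nB t + 1),
      (kraus nA nB (twoL nA nB t) k * T l (midIdx l) * (kraus nA nB (twoL nA nB t) k)ᴴ)
        (Fin.last nB) (Fin.last nB) =
      (cg nA (nB + twoM (twoL nA nB t) k) (2 * l) 0 nA (nB + twoM (twoL nA nB t) k) *
        cg nB nB (twoL nA nB t) (twoM (twoL nA nB t) k) nA
            (nB + twoM (twoL nA nB t) k) ^ 2 : ℝ) * rT := by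
    intro k
    simp only [Matrix.mul_apply, Matrix.conjTranspose_apply, kraus_last_apply, RCLike.star_def,
      Complex.conj_ofReal]
    -- By the selection rule this row of the Kraus operator has at most one nonzero entry, at `m =
    -- j_B + k`. If that weight is inadmissible, both sides vanish.
    by_cases hex : ∃ a : Fin (nA + 1), twoM nA a = nB + twoM (twoL nA nB t) k
    · obtain ⟨a, ha⟩ := hex
      have hz : ∀ a', a' ≠ a → coupledState nB (twoL nA nB t) nA a' (Fin.last nB, k) = 0 := by
        intro a' ha'
        apply coupledState_eq_zero
        rw [twoM_last, ← ha]
        intro h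
        apply ha'
        simp only [twoM] at h
        exact Fin.ext (by omega)
      rw [Finset.sum_eq_single a, Finset.sum_eq_single a]
      · rw [hrT, twoM_midIdx, ← ha, ← twoM_last nB,
          cg_eq (twoL_admissible t).1 (twoL_admissible t).2.1 (twoL_admissible t).2.2.1]
        · push_cast
          ring
      · intro a' _ ha'
        simp [hz a' ha']
      · simp
      · intro a' _ ha'
        simp [hz a' ha']
      · simp
    · push Not at hex
      rw [cg_eq_zero (n₁ := nB) _ _ _ hex]
      have hz : ∀ a', coupledState nB (twoL nA nB t) nA a' (Fin.last nB, k) = 0 := by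
        intro a'
        apply coupledState_eq_zero
        rw [twoM_last]
        exact (hex a').symm
      simp [hz]
  simp only [hterm] at h
  rw [← Finset.sum_mul] at h
  have h2 : scaling T S (extremal nA nB t) l = (∑ k : Fin (twoL nA nB t + 1),
      ((cg nA (nB + twoM (twoL nA nB t) k) (2 * l) 0 nA (nB + twoM (twoL nA nB t) k) *
        cg nB nB (twoL nA nB t) (twoM (twoL nA nB t) k) nA
            (nB + twoM (twoL nA nB t) k) ^ 2 : ℝ) : ℂ)) * rT /
      ((cg nB nB (2 * l) 0 nB nB : ℂ) * rS) := by
    rw [h, mul_div_assoc, div_self (mul_ne_zero hc0 hrS0), mul_one]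
  rw [h2]
  push_cast
  simp only [div_mul_eq_mul_div]
  rw [← Finset.sum_div]
  field_simp

end WignerEckart

/-! ### The rank-one scaling factor -/

section RankOne

theorem Jplus_commutator (n : ℕ) :
    Jplus n * Jminus n - Jminus n * Jplus n = (2 : ℂ) • J n 2 := by
  have h := congrArg (fun M => M.map (fun x : ℝ => (x : ℂ))) (raising_commutator n)
  rw [Jplus, Jminus, ← map_ofReal_mul, ← map_ofReal_mul, J_two']
  ext i j
  have := congrFun (congrFun h i) j
  simpa using this

theorem Jtwo_commutator_Jminus (n : ℕ) : J n 2 * Jminus n - Jminus n * J n 2 = -Jminus n := by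
  have h := congrArg (fun M => M.map (fun x : ℝ => (x : ℂ))) (weight_commutator_lowering n)
  rw [Jminus, J_two', ← map_ofReal_mul, ← map_ofReal_mul]
  ext i j
  have := congrFun (congrFun h i) j
  simpa using this

theorem Jtwo_commutator_Jplus (n : ℕ) : J n 2 * Jplus n - Jplus n * J n 2 = Jplus n := by
  have h := congrArg Matrix.conjTranspose (Jtwo_commutator_Jminus n)
  rw [Matrix.conjTranspose_sub, Matrix.conjTranspose_mul, Matrix.conjTranspose_mul,
    Matrix.conjTranspose_neg, Jminus_conjTranspose, J_isHermitian] at h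
  rw [← neg_sub, h, neg_neg]

theorem tensorGen_mul_vectorize {nA nB : ℕ} {μ : Type*}
    (V : μ → Matrix (Fin (nB + 1)) (Fin (nA + 1)) ℂ) (a : Fin 3) :
    tensorGen nA nB a * vectorize V = vectorize fun k => J nB a * V k - V k * J nA a := by
  ext x k
  rw [tensorGen_mul_vectorize_apply]
  rfl

theorem intertwines_vectorize_of_ladder {nA nB n : ℕ}
    {V : Fin (n + 1) → Matrix (Fin (nB + 1)) (Fin (nA + 1)) ℂ}
    (hp : ∀ k, Jplus nB * V k - V k * Jplus nA = ∑ k', Jplus n k' k • V k')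
    (hm : ∀ k, Jminus nB * V k - V k * Jminus nA = ∑ k', Jminus n k' k • V k')
    (hz : ∀ k, J nB 2 * V k - V k * J nA 2 = ∑ k', J n 2 k' k • V k') :
    Intertwines (tensorGen nA nB) (vectorize V) (J n) := by
  rw [intertwines_iff_ladder, J_plus, J_minus]
  refine ⟨?_, ?_, ?_⟩
  · ext x k
    rw [vectorize_mul_apply, ← hp, ← J_plus, ← J_plus, Matrix.add_mul, Matrix.smul_mul,
      Matrix.add_apply, Matrix.smul_apply, tensorGen_mul_vectorize_apply,
      tensorGen_mul_vectorize_apply]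
    simp only [Matrix.add_mul, Matrix.mul_add, Matrix.smul_mul, Matrix.mul_smul, Matrix.sub_apply,
      Matrix.add_apply, Matrix.smul_apply, smul_eq_mul]
    ring
  · ext x k
    rw [vectorize_mul_apply, ← hm, ← J_minus, ← J_minus, Matrix.sub_mul, Matrix.smul_mul,
      Matrix.sub_apply, Matrix.smul_apply, tensorGen_mul_vectorize_apply,
      tensorGen_mul_vectorize_apply]
    simp only [Matrix.sub_mul, Matrix.mul_sub, Matrix.smul_mul, Matrix.mul_smul, Matrix.sub_apply,
      Matrix.smul_apply, smul_eq_mul]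
    ring
  · ext x k
    rw [vectorize_mul_apply, ← hz, tensorGen_mul_vectorize_apply]

/-- The spherical components of the angular momentum. -/
noncomputable def sphericalJ (n : ℕ) : Fin (2 * 1 + 1) → Op n :=
  ![((1 / Real.sqrt 2 : ℝ) : ℂ) • Jminus n, J n 2, -((1 / Real.sqrt 2 : ℝ) : ℂ) • Jplus n]

theorem Jplus_two : Jplus (2 * 1) =
    !![0, 0, 0; ((Real.sqrt 2 : ℝ) : ℂ), 0, 0; 0, ((Real.sqrt 2 : ℝ) : ℂ), 0] := by
  have h : (1 + 1 : ℝ) * (2 - 1) = 2 := by norm_num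
  ext i j
  fin_cases i <;> fin_cases j <;> simp [Jplus, raising_apply]
  rw [← Complex.ofReal_mul, ← Real.sqrt_mul (by norm_num), h]

theorem Jminus_two : Jminus (2 * 1) =
    !![0, ((Real.sqrt 2 : ℝ) : ℂ), 0; 0, 0, ((Real.sqrt 2 : ℝ) : ℂ); 0, 0, 0] := by
  rw [← transpose_Jplus, Jplus_two]
  ext i j
  fin_cases i <;> fin_cases j <;> rfl

theorem Jz_two : J (2 * 1) 2 = !![-1, 0, 0; 0, 0, 0; 0, 0, 1] := by
  ext i j
  fin_cases i <;> fin_cases j <;> simp [J_two, mag_eq]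
  norm_num

/-- The commutation relations say that the adjoint action on the spherical components is given by
the spin-one matrices. -/
theorem sphericalJ_intertwines (n : ℕ) :
    Intertwines (tensorGen n n) (vectorize (sphericalJ n)) (J (2 * 1)) := by
  have h3 : ((Real.sqrt 2 : ℝ) : ℂ) * ((Real.sqrt 2 : ℝ) : ℂ) = 2 := by
    rw [← Complex.ofReal_mul, Real.mul_self_sqrt (by norm_num)]
    norm_num
  obtain ⟨r, hr1, hr2⟩ : ∃ r : ℂ, ((1 / Real.sqrt 2 : ℝ) : ℂ) = r ∧
      r * ((Real.sqrt 2 : ℝ) : ℂ) = 1 := by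
    refine ⟨_, rfl, ?_⟩
    rw [← Complex.ofReal_mul, one_div_mul_cancel (by positivity)]
    norm_num
  have hr3 : r * 2 = ((Real.sqrt 2 : ℝ) : ℂ) := by
    rw [← h3, ← mul_assoc, hr2, one_mul]
  have hpm := Jplus_commutator n
  have hzm := Jtwo_commutator_Jminus n
  have hzp := Jtwo_commutator_Jplus n
  have e0 : sphericalJ n 0 = r • Jminus n := by rw [← hr1]; rfl
  have e1 : sphericalJ n 1 = J n 2 := rfl
  have e2 : sphericalJ n 2 = -r • Jplus n := by rw [← hr1]; rfl
  have hJp := Jplus_two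
  have hJm := Jminus_two
  -- Only `r * s = 1` and `r * 2 = s` matter from here on, so each case is linear in the
  -- commutators.
  generalize ((Real.sqrt 2 : ℝ) : ℂ) = s at *
  apply intertwines_vectorize_of_ladder
  · intro k
    fin_cases k
    · change Jplus n * sphericalJ n 0 - sphericalJ n 0 * Jplus n = _
      rw [Fin.sum_univ_three, hJp, e0, e1, e2]
      simp only [Matrix.mul_smul, Matrix.smul_mul]
      simp
      linear_combination (norm := module) r • hpm + hr3 • J n 2
    · change Jplus n * sphericalJ n 1 - sphericalJ n 1 * Jplus n = _
      rw [Fin.sum_univ_three, hJp, e0, e1, e2]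
      simp
      linear_combination (norm := module) -hzp + hr2 • Jplus n
    · change Jplus n * sphericalJ n 2 - sphericalJ n 2 * Jplus n = _
      rw [Fin.sum_univ_three, hJp, e0, e1, e2]
      simp only [Matrix.mul_smul, Matrix.smul_mul]
      simp
  · intro k
    fin_cases k
    · change Jminus n * sphericalJ n 0 - sphericalJ n 0 * Jminus n = _
      rw [Fin.sum_univ_three, hJm, e0, e1, e2]
      simp only [Matrix.mul_smul, Matrix.smul_mul]
      simp
    · change Jminus n * sphericalJ n 1 - sphericalJ n 1 * Jminus n = _
      rw [Fin.sum_univ_three, hJm, e0, e1, e2]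
      simp
      linear_combination (norm := module) -hzm - hr2 • Jminus n
    · change Jminus n * sphericalJ n 2 - sphericalJ n 2 * Jminus n = _
      rw [Fin.sum_univ_three, hJm, e0, e1, e2]
      simp only [Matrix.mul_smul, Matrix.smul_mul]
      simp
      linear_combination (norm := module) r • hpm + hr3 • J n 2
  · intro k
    fin_cases k
    · change J n 2 * sphericalJ n 0 - sphericalJ n 0 * J n 2 = _
      rw [Fin.sum_univ_three, Jz_two, e0, e1, e2]
      simp only [Matrix.mul_smul, Matrix.smul_mul]
      simp
      linear_combination (norm := module) r • hzm
    · change J n 2 * sphericalJ n 1 - sphericalJ n 1 * J n 2 = _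
      rw [Fin.sum_univ_three, Jz_two, e0, e1, e2]
      simp
    · change J n 2 * sphericalJ n 2 - sphericalJ n 2 * J n 2 = _
      rw [Fin.sum_univ_three, Jz_two, e0, e1, e2]
      simp only [Matrix.mul_smul, Matrix.smul_mul]
      simp
      linear_combination (norm := module) -r • hzp

theorem casimir_transpose (n : ℕ) :
    ∑ a, -(J n a)ᵀ * -(J n a)ᵀ = ((spin n * (spin n + 1) : ℝ) : ℂ) • (1 : Op n) := by
  have h := congrArg Matrix.transpose (casimir n)
  rw [Matrix.transpose_sum, Matrix.transpose_smul, Matrix.transpose_one] at h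
  rw [← h]
  exact Finset.sum_congr rfl fun a _ => by rw [neg_mul_neg, Matrix.transpose_mul]

variable {nA nB : ℕ}

/-- The Casimir relation for the Kraus operators. -/
theorem sum_J_mul_kraus_mul_J {n : ℕ} (h₁ : nB ≤ n + nA) (h₂ : n ≤ nB + nA) (k : Fin (n + 1)) :
    ∑ a, J nB a * kraus nA nB n k * J nA a =
      (((spin nA * (spin nA + 1) + spin nB * (spin nB + 1) - spin n * (spin n + 1)) / 2 : ℝ) : ℂ) •
        kraus nA nB n k := by
  have hV := kraus_intertwines h₁ h₂
  have h1 : ∑ a, tensorGen nA nB a * (tensorGen nA nB a * vectorize (kraus nA nB n)) =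
      ((spin n * (spin n + 1) : ℝ) : ℂ) • vectorize (kraus nA nB n) := by
    rw [← Matrix.mul_one (vectorize (kraus nA nB n)), ← Matrix.mul_smul, ← casimir_transpose,
      Matrix.mul_one, Matrix.mul_sum]
    refine Finset.sum_congr rfl fun a _ => ?_
    rw [hV a, ← Matrix.mul_assoc, hV a, Matrix.mul_assoc]
  have h2 : ∑ a, (J nB a * (J nB a * kraus nA nB n k - kraus nA nB n k * J nA a) -
      (J nB a * kraus nA nB n k - kraus nA nB n k * J nA a) * J nA a) =
      ((spin n * (spin n + 1) : ℝ) : ℂ) • kraus nA nB n k := by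
    simp only [tensorGen_mul_vectorize] at h1
    ext b a
    have := congrFun (congrFun h1 (b, a)) k
    rw [Matrix.sum_apply] at this ⊢
    exact this
  -- The total Casimir expands into those of `B` and `A` minus twice the cross term. On the Kraus
  -- operators it is the spin-`n/2` scalar.
  have h3 : ∑ a, (J nB a * (J nB a * kraus nA nB n k - kraus nA nB n k * J nA a) -
      (J nB a * kraus nA nB n k - kraus nA nB n k * J nA a) * J nA a) =
      (∑ a, J nB a * J nB a) * kraus nA nB n k + kraus nA nB n k * (∑ a, J nA a * J nA a) -
        (2 : ℂ) • ∑ a, J nB a * kraus nA nB n k * J nA a := by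
    rw [Matrix.sum_mul, Matrix.mul_sum, Finset.smul_sum, ← Finset.sum_add_distrib,
      ← Finset.sum_sub_distrib]
    refine Finset.sum_congr rfl fun a _ => ?_
    simp only [Matrix.mul_sub, Matrix.sub_mul, Matrix.mul_assoc]
    module
  rw [h2, casimir, casimir, Matrix.smul_mul, Matrix.mul_smul, Matrix.one_mul, Matrix.mul_one] at h3
  push_cast at h3 ⊢
  linear_combination (norm := module) (1 / 2 : ℂ) • h3

theorem sphericalJ_one (n : ℕ) : sphericalJ n 1 = J n 2 := rfl

theorem Jminus_eq_sphericalJ (n : ℕ) :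
    Jminus n = ((Real.sqrt 2 : ℝ) : ℂ) • sphericalJ n 0 := by
  change _ = ((Real.sqrt 2 : ℝ) : ℂ) • ((1 / Real.sqrt 2 : ℝ) : ℂ) • Jminus n
  rw [smul_smul, ← Complex.ofReal_mul, mul_one_div_cancel (by positivity)]
  simp

theorem Jplus_eq_sphericalJ (n : ℕ) :
    Jplus n = (-((Real.sqrt 2 : ℝ) : ℂ)) • sphericalJ n 2 := by
  change _ = (-((Real.sqrt 2 : ℝ) : ℂ)) • (-((1 / Real.sqrt 2 : ℝ) : ℂ)) • Jplus n
  rw [smul_smul, neg_mul_neg, ← Complex.ofReal_mul, mul_one_div_cancel (by positivity)]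
  simp

theorem J_two_ne_zero {n : ℕ} (hn : 1 ≤ n) : J n 2 ≠ 0 := by
  intro h
  have := congrFun (congrFun h (Fin.last n)) (Fin.last n)
  rw [J_two, Matrix.diagonal_apply_eq, mag_eq, Fin.val_last, Matrix.zero_apply,
    Complex.ofReal_eq_zero] at this
  have h1 : (1 : ℝ) ≤ n := by exact_mod_cast hn
  linarith

/-- A covariant channel maps the angular momentum to a multiple of the angular momentum. -/
theorem IsCovariantChannel.exists_map_J {S : (l : ℕ) → Fin (2 * l + 1) → Op nB}
    (hS : IsITOBasis nB S) {E : Op nA →ₗ[ℂ] Op nB} (hE : IsCovariantChannel E) (hB : 1 ≤ nB) :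
    ∃ g : ℂ, ∀ a, E (J nA a) = g • J nB a := by
  obtain ⟨c, hc⟩ := hS.exists_smul hB (hE.map_intertwines (sphericalJ_intertwines nA))
  obtain ⟨d, hd⟩ := hS.exists_smul hB (sphericalJ_intertwines nB)
  have hd0 : d ≠ 0 := by
    rintro rfl
    exact J_two_ne_zero hB (by rw [← sphericalJ_one, hd, zero_smul])
  have hk : ∀ k, E (sphericalJ nA k) = (c / d) • sphericalJ nB k := fun k => by
    rw [hc, hd, smul_smul, div_mul_cancel₀ _ hd0]
  have hp : E (Jplus nA) = (c / d) • Jplus nB := by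
    rw [Jplus_eq_sphericalJ, Jplus_eq_sphericalJ, map_smul, hk, smul_comm]
  have hm : E (Jminus nA) = (c / d) • Jminus nB := by
    rw [Jminus_eq_sphericalJ, Jminus_eq_sphericalJ, map_smul, hk, smul_comm]
  refine ⟨c / d, fun a => ?_⟩
  fin_cases a
  · change E (J nA 0) = (c / d) • J nB 0
    rw [J_zero, J_zero, map_smul, map_add, hp, hm, ← smul_add, smul_comm]
  · change E (J nA 1) = (c / d) • J nB 1
    rw [J_one, J_one, map_smul, map_sub, hp, hm, ← smul_sub, smul_comm]
  · exact hk 1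

theorem trace_casimir (n : ℕ) :
    ∑ a, (J n a * J n a).trace = ((spin n * (spin n + 1) * (n + 1) : ℝ) : ℂ) := by
  rw [← Matrix.trace_sum, casimir, Matrix.trace_smul, Matrix.trace_one, Fintype.card_fin]
  push_cast
  rfl

/-- The constant is found by evaluating `∑ₐ tr(J_B^a E(J_A^a))` twice: by proportionality and the
Casimir of `B`, and through the Kraus operators, where the cross-term identity factors out a scalar
times `d_A`. -/
theorem extremal_J {S : (l : ℕ) → Fin (2 * l + 1) → Op nB} (hS : IsITOBasis nB S) (hB : 1 ≤ nB)
    (t : Fin (min nA nB + 1)) (a : Fin 3) : extremal nA nB t (J nA a) =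
      (((spin nA * (spin nA + 1) + spin nB * (spin nB + 1) -
          spin (twoL nA nB t) * (spin (twoL nA nB t) + 1)) / 2 * (nA + 1) /
        (spin nB * (spin nB + 1) * (nB + 1)) : ℝ) : ℂ) • J nB a := by
  obtain ⟨g, hg⟩ := (extremal_isCovariantChannel t).exists_map_J hS hB
  rw [hg]
  congr 1
  have h1 : ∑ a, (J nB a * extremal nA nB t (J nA a)).trace =
      g * ((spin nB * (spin nB + 1) * (nB + 1) : ℝ) : ℂ) := by
    simp only [hg, Matrix.mul_smul, Matrix.trace_smul, smul_eq_mul]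
    rw [← Finset.mul_sum, trace_casimir]
  have h2 : ∑ a, (J nB a * extremal nA nB t (J nA a)).trace =
      (((spin nA * (spin nA + 1) + spin nB * (spin nB + 1) -
          spin (twoL nA nB t) * (spin (twoL nA nB t) + 1)) / 2 : ℝ) : ℂ) * (nA + 1) := by
    have h3 : ∑ k, ((kraus nA nB (twoL nA nB t) k) * (kraus nA nB (twoL nA nB t) k)ᴴ).trace =
        (nA : ℂ) + 1 := by
      have := congrArg Matrix.trace (sum_kraus (twoL_admissible t).1 (twoL_admissible t).2.1
        (twoL_admissible t).2.2.1 (twoL_admissible t).2.2.2)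
      rw [Matrix.trace_one, Fintype.card_fin, Matrix.trace_sum] at this
      push_cast at this
      rw [← this]
      exact Finset.sum_congr rfl fun k _ => Matrix.trace_mul_comm _ _
    rw [← h3, Finset.mul_sum]
    simp only [extremal_apply, Matrix.mul_sum, Matrix.trace_sum]
    rw [Finset.sum_comm]
    refine Finset.sum_congr rfl fun k _ => ?_
    rw [← smul_eq_mul, ← Matrix.trace_smul, ← Matrix.smul_mul,
      ← sum_J_mul_kraus_mul_J (twoL_admissible t).1 (twoL_admissible t).2.1, Matrix.sum_mul,
      Matrix.trace_sum]
    simp only [Matrix.mul_assoc]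
  have h0 : (spin nB * (spin nB + 1) * (nB + 1) : ℝ) ≠ 0 := by
    have : (1 : ℝ) ≤ nB := by exact_mod_cast hB
    rw [spin]
    positivity
  rw [Complex.ofReal_div, eq_div_iff (Complex.ofReal_ne_zero.mpr h0), ← h1, h2]
  push_cast
  rfl

theorem fOne_mul_spinLength (hA : 1 ≤ nA) (hB : 1 ≤ nB) (L : ℝ) :
    (spin nA * (spin nA + 1) + spin nB * (spin nB + 1) - L * (L + 1)) / 2 * (nA + 1) /
        (spin nB * (spin nB + 1) * (nB + 1)) * spinLength nB =
      fOne (spin nA) (spin nB) L * spinLength nA := by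
  have hA' : 0 < spin nA * (spin nA + 1) := by
    have : (1 : ℝ) ≤ nA := by exact_mod_cast hA
    rw [spin]
    positivity
  have hB' : 0 < spin nB * (spin nB + 1) := by
    have : (1 : ℝ) ≤ nB := by exact_mod_cast hB
    rw [spin]
    positivity
  have dA : 2 * spin nA + 1 = nA + 1 := by rw [spin]; ring
  have dB : 2 * spin nB + 1 = nB + 1 := by rw [spin]; ring
  -- The square root in `fOne` converts `‖J_A‖` into `(d_A/d_B)‖J_B‖`.
  have h : Real.sqrt ((spin nB * (spin nB + 1) * (2 * spin nA + 1)) /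
      (spin nA * (spin nA + 1) * (2 * spin nB + 1))) * spinLength nA =
      (nA + 1) / (nB + 1) * spinLength nB := by
    rw [spinLength, spinLength, dA, dB, ← Real.sqrt_mul (by positivity)]
    rw [← Real.sqrt_sq (show (0 : ℝ) ≤ (nA + 1) / (nB + 1) by positivity),
      ← Real.sqrt_mul (by positivity)]
    congr 1
    have := hA'.ne'
    have := hB'.ne'
    generalize spin nA * (spin nA + 1) = x at *
    generalize spin nB * (spin nB + 1) = y at *
    field_simp
  rw [fOne, mul_assoc _ (Real.sqrt _), h]
  have h1 : spin nB ≠ 0 := fun h => by simp [h] at hB'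
  have h2 : spin nB + 1 ≠ 0 := fun h => by simp [h] at hB'
  field_simp

theorem spinLength_pos {n : ℕ} (hn : 1 ≤ n) : 0 < spinLength n := by
  have : (1 : ℝ) ≤ n := by exact_mod_cast hn
  rw [spinLength, spin]
  exact Real.sqrt_pos.mpr (by positivity)

/-- The closed form of the rank-one scaling factor. -/
theorem extremal_normJ {S : (l : ℕ) → Fin (2 * l + 1) → Op nB} (hS : IsITOBasis nB S)
    (hA : 1 ≤ nA) (hB : 1 ≤ nB) (t : Fin (min nA nB + 1)) (a : Fin 3) :
    extremal nA nB t (normJ nA a) =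
      (fOne (spin nA) (spin nB) (spin (twoL nA nB t)) : ℂ) • normJ nB a := by
  rw [normJ, normJ, map_smul, extremal_J hS hB, smul_smul, smul_smul]
  congr 1
  have h := fOne_mul_spinLength hA hB (spin (twoL nA nB t))
  have h1 := (spinLength_pos hA).ne'
  have h2 := (spinLength_pos hB).ne'
  rw [← Complex.ofReal_inv, ← Complex.ofReal_inv, ← Complex.ofReal_mul, ← Complex.ofReal_mul]
  congr 1
  rw [inv_div, inv_div, div_mul_eq_mul_div, mul_div_assoc' (fOne _ _ _), div_eq_div_iff h1 h2]
  linear_combination Real.sqrt 3 * h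

end RankOne

end SU2Channel

/-! ### Assembly of the theorem. -/

theorem mainTheorem11 (nA nB : ℕ)
    (T : (l : ℕ) → Fin (2 * l + 1) → Op nA) (S : (l : ℕ) → Fin (2 * l + 1) → Op nB)
    (hT : IsITOBasis nA T) (hS : IsITOBasis nB S) :
    -- the maps `E^L` are covariant channels with Jamiołkowski operator `I^L / (2L+1)`
    (∀ t : Fin (min nA nB + 1),
      IsCovariantChannel (extremal nA nB t) ∧
      jamiolkowski (extremal nA nB t) =
        (1 / ((twoL nA nB t : ℂ) + 1)) • irrepProjector nA nB (twoL nA nB t) ∧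
      Module.finrank ℂ (irrepSubspace nA nB (twoL nA nB t)) = twoL nA nB t + 1) ∧
    -- covariant channels correspond bijectively to probability distributions
    (∀ E : Op nA →ₗ[ℂ] Op nB, IsCovariantChannel E →
      ∃! p : Fin (min nA nB + 1) → ℝ,
        p ∈ stdSimplex ℝ (Fin (min nA nB + 1)) ∧
        E = ∑ t, (p t : ℂ) • extremal nA nB t) ∧
    (∀ p ∈ stdSimplex ℝ (Fin (min nA nB + 1)),
      IsCovariantChannel (∑ t, (p t : ℂ) • extremal nA nB t)) ∧
    -- a covariant channel scales irreducible tensor operators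
    (∀ E : Op nA →ₗ[ℂ] Op nB, IsCovariantChannel E →
      (∀ l ≤ min nA nB, ∀ k, E (T l k) = scaling T S E l • S l k) ∧
      (∀ l ≤ nA, nB < l → ∀ k, E (T l k) = 0)) ∧
    -- the action of a covariant channel in terms of `p` and of the factors `f_l(E^L)`
    (∀ p ∈ stdSimplex ℝ (Fin (min nA nB + 1)),
      (∀ l ≤ min nA nB, scaling T S (∑ t, (p t : ℂ) • extremal nA nB t) l =
        ∑ t, (p t : ℂ) * scaling T S (extremal nA nB t) l) ∧
      ∀ X : Op nA, (∑ t, (p t : ℂ) • extremal nA nB t) X =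
        ∑ t, ∑ l ∈ Finset.range (min nA nB + 1), ∑ k,
          ((p t : ℂ) * scaling T S (extremal nA nB t) l * ((T l k)ᴴ * X).trace) • S l k) ∧
    -- the Clebsch–Gordan formula for `f_l(E^L)`, with the reduced matrix elements of `T` and `S`
    (∃ rT rS : ℕ → ℂ,
      (∀ l ≤ nA, IsReducedElement nA l (T l) (rT l)) ∧
      (∀ l ≤ nB, IsReducedElement nB l (S l) (rS l)) ∧
      ∀ l ≤ min nA nB,
        rS l ≠ 0 ∧ cg nB nB (2 * l) 0 nB nB ≠ 0 ∧
        ∀ t : Fin (min nA nB + 1),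
          scaling T S (extremal nA nB t) l =
            rT l / rS l *
              ((∑ k : Fin (twoL nA nB t + 1),
                cg nA (nB + twoM (twoL nA nB t) k) (2 * l) 0 nA (nB + twoM (twoL nA nB t) k) /
                    cg nB nB (2 * l) 0 nB nB *
                  cg nB nB (twoL nA nB t) (twoM (twoL nA nB t) k) nA
                    (nB + twoM (twoL nA nB t) k) ^ 2 : ℝ) : ℂ)) ∧
    -- the closed form for `l = 1`
    (1 ≤ min nA nB → ∀ t : Fin (min nA nB + 1),
      (T 1 (midIdx 1) = normJ nA 2 → S 1 (midIdx 1) = normJ nB 2 →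
        scaling T S (extremal nA nB t) 1 =
          (fOne (spin nA) (spin nB) (spin (twoL nA nB t)) : ℂ)) ∧
      ∀ a : Fin 3, extremal nA nB t (normJ nA a) =
        (fOne (spin nA) (spin nB) (spin (twoL nA nB t)) : ℂ) • normJ nB a) := by
  refine ⟨fun t => ⟨extremal_isCovariantChannel t, jamiolkowski_extremal nA nB t,
      finrank_irrepSubspace t⟩, fun E hE => hE.existsUnique,
    fun p hp => IsCovariantChannel.convexCombination hp extremal_isCovariantChannel,
    fun E hE => ⟨fun l hl k => hE.map_tensor hT hS (by omega) (by omega) k,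
      fun l hl hB k => hE.map_tensor_eq_zero hT hS hl hB k⟩,
    fun p hp => ⟨fun l _ => scaling_sum_smul _ _ l, fun X => ?_⟩, ?_, fun h1 t => ⟨?_, ?_⟩⟩
  · simp only [LinearMap.sum_apply, LinearMap.smul_apply]
    refine Finset.sum_congr rfl fun t _ => ?_
    rw [(extremal_isCovariantChannel t).apply_eq hT hS X, Finset.smul_sum]
    refine Finset.sum_congr rfl fun l _ => ?_
    rw [Finset.smul_sum]
    exact Finset.sum_congr rfl fun k _ => by rw [smul_smul, mul_assoc]
  · choose rT hrT using fun l => fun h : l ≤ nA => hT.exists_isReducedElement h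
    choose rS hrS using fun l => fun h : l ≤ nB => hS.exists_isReducedElement h
    -- The value `0` beyond the existing ranks is arbitrary.
    refine ⟨fun l => if h : l ≤ nA then rT l h else 0, fun l => if h : l ≤ nB then rS l h else 0,
      fun l hl => by simpa [hl] using hrT l hl, fun l hl => by simpa [hl] using hrS l hl,
      fun l hl => ?_⟩
    have hA : l ≤ nA := by omega
    have hB : l ≤ nB := by omega
    -- A zero reduced element would kill the normalised operator `S^l_0`.
    have h0 : rS l hB ≠ 0 := by
      intro h
      apply hS.ne_zero hB (midIdx l)
      ext m' m
      rw [hrS l hB, h, mul_zero, Matrix.zero_apply]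
    simp only [hA, hB, dif_pos]
    exact ⟨h0, cg_highest_ne_zero hB,
      fun t => scaling_extremal hT hS hA hB (hrT l hA) (hrS l hB) h0 t⟩
  · intro hT1 hS1
    have ho := hS.orthonormal 1 (by omega) 1 (by omega) (midIdx 1) (midIdx 1)
    rw [scaling, hT1, extremal_normJ hS (by omega) (by omega), ← hS1, Matrix.mul_smul,
      Matrix.trace_smul, ho]
    simp
  · exact extremal_normJ hS (by omega) (by omega) t
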